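/- Let $\mathbb D=\{z\in\mathbb C:|z|\le 1\}$ and $d(z)=1-|z|^2$. Directed lines meeting $\mathbb D$ are parametrized by $\partial_+S\mathbb D=\mathbb S^1\times[-\pi/2,\pi/2]\ni(\beta,\alpha)$ (with $\mathbb S^1=\mathbb R/2\pi\mathbb Z$) via $\gamma_{\beta,\alpha}(t)=e^{i\beta}+te^{i(\beta+\pi+\alpha)}$, $0\le t\le 2\cos\alpha$, and $\mu(\beta,\alpha)=\cos\alpha$. Let $I_0f(\beta,\alpha)=\int_0^{2\cos\alpha}f(\gamma_{\beta,\alpha}(t))\,dt$ and $I_0^\sharp g(z)=\int_{\mathbb S^1}g(\beta_-(z,\theta),\alpha_-(z,\theta))\,d\theta$, where $(\beta_-,\alpha_-)(z,\theta)$ are the coordinates of the line through $z$ with direction $e^{i\theta}$. Write $L^2(\mathbb D,d^\gamma)$ for the $L^2$ space of the measure $d^\gamma|dz|^2$ and $L^2(\partial_+S\mathbb D,\mu^{-2\gamma})$ for that of $\mu^{-2\gamma}\,d\beta\,d\alpha$. A function $g$ on $\partial_+S\mathbb D$ is called even (odd) if $g\circ S_A=g$ (resp. $g\circ S_A=-g$),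 where $S_A(\beta,\alpha)=(\beta+\pi+2\alpha,-\alpha)$ reverses the direction of a line; $L^2_+(\partial_+S\mathbb D,\mu^{-2\gamma})$ is the subspace of even functions. The hat $\widehat{\,\cdot\,}$ denotes normalization in the respective space. Fix $\gamma>-1$. Then $I_0d^\gamma:f\mapsto I_0(d^\gamma f)$ is a bounded operator $L^2(\mathbb D,d^\gamma)\to L^2(\partial_+S\mathbb D,\mu^{-2\gamma})$ with values in $L^2_+(\partial_+S\mathbb D,\mu^{-2\gamma})$, and its Hilbert adjoint is $I_0^\sharp\mu^{-2\gamma-1}$; both are given by the above integrals, which converge absolutely almost everywhere. For $n\ge0$ let $L_n^\gamma$ be an $n$-th orthogonal polynomial (real, of degree $n$, with any normalization) for the weight $(1-x^2)^{\gamma+1/2}$ on $[-1,1]$. For $k\in\mathbb Z$ put $$\psi_{n,k}^\gamma=\mu^{2\gamma+1}\frac{(-1)^n}{2\pi}e^{i(n-2k)(\beta+\alpha)}L_n^\gamma(\sin\alpha),\qquad G_{n,k}^\gamma=I_0^\sharp\mu^{-2\gamma-1}\psi_{n,k}^\gamma .$$ Then $\psi_{n,k}^\gamma\in L^2(\partial_+S\mathbb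 D,\mu^{-2\gamma})$ and the following hold. (1) The kernel of $I_0^\sharp\mu^{-2\gamma-1}$ in $L^2_+(\partial_+S\mathbb D,\mu^{-2\gamma})$ is the closed linear span $N$ of $\{\psi_{n,k}^\gamma: n\ge0,\ k<0\text{ or }k>n\}$. Its kernel in all of $L^2(\partial_+S\mathbb D,\mu^{-2\gamma})$ is the sum of $N$ and the space of odd functions. (2) The singular value decomposition of $$I_0d^\gamma: L^2(\mathbb D,d^\gamma)\to L^2(\partial_+S\mathbb D,\mu^{-2\gamma})/\ker(I_0^\sharp\mu^{-2\gamma-1})$$ is $(\widehat{G_{n,k}^\gamma},\widehat{\psi_{n,k}^\gamma},\sigma_{n,k}^\gamma)_{n\ge0,\,0\le k\le n}$: the $\widehat{G_{n,k}^\gamma}$ form a complete orthonormal system of $L^2(\mathbb D,d^\gamma)$, the classes of the $\widehat{\psi_{n,k}^\gamma}$ form a complete orthonormal system of the quotient, and $I_0d^\gamma\,\widehat{G_{n,k}^\gamma}=\sigma_{n,k}^\gamma\widehat{\psi_{n,k}^\gamma}$, $I_0^\sharp\mu^{-2\gamma-1}\widehat{\psi_{n,k}^\gamma}=\sigma_{n,k}^\gamma\widehat{G_{n,k}^\gamma}$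 (also before passing to the quotient), where $\sigma_{n,k}^\gamma>0$ and $$(\sigma_{n,k}^\gamma)^2=2^{2\gamma+2}\pi\binom nk\frac{\Gamma(n-k+\gamma+1)\Gamma(k+\gamma+1)}{\Gamma(n+2\gamma+2)}=\frac{2^{2\gamma+2}\pi}{n+1}\,\frac{B(n-k+1+\gamma,k+1+\gamma)}{B(n-k+1,k+1)},$$ with $B(x,y)=\Gamma(x)\Gamma(y)/\Gamma(x+y)$. -/

import Mathlib

open MeasureTheory Set
open scoped ENNReal Real

noncomputable section

namespace XRaySVD

instance instFactTwoPiPos : Fact (0 < 2 * π) := ⟨Real.two_pi_pos⟩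

/-- The circle `𝕊¹ = ℝ / 2πℤ`; its `volume` is arc length (total mass `2π`). -/
abbrev S1 : Type := AddCircle (2 * π)

/-- The unit complex number `e^{iθ}`, for `θ ∈ ℝ / 2πℤ`. -/
def cis (θ : S1) : ℂ := (AddCircle.toCircle θ : ℂ)

/-- The boundary defining function `d(z) = 1 - |z|²` of the closed unit disk. -/
def dBdf (z : ℂ) : ℝ := 1 - ‖z‖ ^ 2

/-- The boundary defining function `μ(β, α) = cos α` of the space of directed lines. -/
def muBdf (p : S1 × ℝ) : ℝ := Real.cos p.2

/-- The measure `d^γ |dz|²` on the closed unit disk (as a measure on `ℂ`). -/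
def diskMeasure (γ : ℝ) : Measure ℂ :=
  (volume.restrict (Metric.closedBall (0 : ℂ) 1)).withDensity
    (fun z => ENNReal.ofReal (dBdf z ^ γ))

/-- The measure `μ^{-2γ} dβ dα` on the set of directed lines, in fan-beam coordinates
`(β, α) ∈ 𝕊¹ × [-π/2, π/2]`. -/
def fanMeasure (γ : ℝ) : Measure (S1 × ℝ) :=
  ((volume : Measure (S1 × ℝ)).restrict (univ ×ˢ Icc (-(π / 2)) (π / 2))).withDensity
    (fun p => ENNReal.ofReal (muBdf p ^ (-2 * γ)))

/-- `L²(𝔻, d^γ)`. -/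
abbrev L2Disk (γ : ℝ) := Lp ℂ 2 (diskMeasure γ)

/-- `L²(∂₊S𝔻, μ^{-2γ})`. -/
abbrev L2Fan (γ : ℝ) := Lp ℂ 2 (fanMeasure γ)

/-- The directed line `γ_{β,α}(t) = e^{iβ} + t e^{i(β+π+α)}`. -/
def chord (p : S1 × ℝ) (t : ℝ) : ℂ :=
  cis p.1 + t * cis (p.1 + ((π + p.2 : ℝ) : S1))

/-- The X-ray transform `I₀ f(β,α) = ∫_0^{2 cos α} f(γ_{β,α}(t)) dt`. -/
def xray (f : ℂ → ℂ) (p : S1 × ℝ) : ℂ :=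
  ∫ t in (0 : ℝ)..(2 * Real.cos p.2), f (chord p t)

/-- The fan-beam coordinates `(β₋, α₋)(z, θ)` of the line through `z` with direction `e^{iθ}`:
`α₋ = arcsin (Im (z e^{-iθ}))` and `β₋ = θ - π - α₋`; see `fanCoord_spec`. -/
def fanCoord (z : ℂ) (θ : S1) : S1 × ℝ :=
  let a : ℝ := Real.arcsin ((z * cis (-θ)).im)
  (θ - ((π + a : ℝ) : S1), a)

/-- The backprojection `I₀^♯ g(z) = ∫_{𝕊¹} g(β₋(z,θ), α₋(z,θ)) dθ`. -/
def backproj (g : S1 × ℝ → ℂ) (z : ℂ) : ℂ := ∫ θ : S1, g (fanCoord z θ)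

lemma cis_add (a b : S1) : cis (a + b) = cis a * cis b := by
  simp [cis, AddCircle.toCircle_add]

lemma cis_coe (x : ℝ) : cis (x : S1) = Complex.exp (x * Complex.I) := by
  have h : (2 * π / (2 * π) : ℝ) = 1 := div_self Real.two_pi_pos.ne'
  rw [cis, AddCircle.toCircle_apply_mk, h, one_mul, Circle.coe_exp]

lemma cis_mul_neg (a : S1) : cis a * cis (-a) = 1 := by
  rw [← cis_add]; simp [cis]

/-- `fanCoord z θ` are the unique `(β, α)` such that the line `γ_{β,α}` has direction `e^{iθ}` and
passes through `z`. -/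
lemma fanCoord_spec {z : ℂ} (hz : ‖z‖ ≤ 1) (θ : S1) (p : S1 × ℝ) :
    fanCoord z θ = p ↔ p.2 ∈ Icc (-(π / 2)) (π / 2) ∧ p.1 + ((π + p.2 : ℝ) : S1) = θ ∧
      ∃ t ∈ Icc (0 : ℝ) (2 * Real.cos p.2), chord p t = z := by
  have key : ∀ a : ℝ, cis (θ - ((π + a : ℝ) : S1)) * cis (-θ)
      = -(Real.cos a : ℂ) + (Real.sin a : ℂ) * Complex.I := by
    intro a
    have h1 : θ - ((π + a : ℝ) : S1) = θ + ((-(π + a) : ℝ) : S1) := by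
      rw [sub_eq_add_neg]; rfl
    rw [h1, cis_add, mul_right_comm, cis_mul_neg, one_mul, cis_coe, Complex.exp_mul_I,
      ← Complex.ofReal_cos, ← Complex.ofReal_sin]
    have e1 : Real.cos (-(π + a)) = -Real.cos a := by
      rw [Real.cos_neg, add_comm, Real.cos_add_pi]
    have e2 : Real.sin (-(π + a)) = Real.sin a := by
      rw [Real.sin_neg, add_comm, Real.sin_add_pi, neg_neg]
    rw [e1, e2]; simp
  have hchord : ∀ (a t : ℝ), chord (θ - ((π + a : ℝ) : S1), a) t * cis (-θ)
      = ((t - Real.cos a : ℝ) : ℂ) + (Real.sin a : ℂ) * Complex.I := by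
    intro a t
    have h2 := key a
    simp only [chord, sub_add_cancel]
    rw [add_mul, mul_assoc, cis_mul_neg, h2]
    push_cast; ring
  have hnorm : ‖z * cis (-θ)‖ ≤ 1 := by
    rw [norm_mul, cis, Circle.norm_coe, mul_one]; exact hz
  set w := z * cis (-θ) with hw
  have hwim : |w.im| ≤ 1 := (Complex.abs_im_le_norm w).trans hnorm
  have hsq : w.re ^ 2 + w.im ^ 2 ≤ 1 := by
    have h := Complex.sq_norm w
    rw [Complex.normSq_apply] at h
    nlinarith [norm_nonneg w]
  constructor
  · rintro rfl
    have hs : Real.sin (Real.arcsin w.im) = w.im :=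
      Real.sin_arcsin (abs_le.1 hwim).1 (abs_le.1 hwim).2
    have hc : |w.re| ≤ Real.cos (Real.arcsin w.im) := by
      rw [Real.cos_arcsin]
      exact Real.abs_le_sqrt (by linarith)
    refine ⟨Real.arcsin_mem_Icc _, sub_add_cancel _ _,
      w.re + Real.cos (Real.arcsin w.im), ⟨?_, ?_⟩, ?_⟩
    · linarith [(abs_le.1 hc).1]
    · have := (abs_le.1 hc).2
      simp only [fanCoord, ← hw]; linarith
    · have h3 := hchord (Real.arcsin w.im) (w.re + Real.cos (Real.arcsin w.im))
      have h4 : chord (fanCoord z θ) (w.re + Real.cos (Real.arcsin w.im)) * cis (-θ)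
          = z * cis (-θ) := by
        rw [← hw]
        refine Eq.trans h3 ?_
        rw [hs, add_sub_cancel_right, Complex.re_add_im]
      have hne : cis (-θ) ≠ 0 := right_ne_zero_of_mul_eq_one (cis_mul_neg θ)
      exact mul_right_cancel₀ hne h4
  · obtain ⟨b, a⟩ := p
    rintro ⟨ha, hb, t, -, ht⟩
    have hb' : b = θ - ((π + a : ℝ) : S1) := eq_sub_of_add_eq hb
    subst hb'
    have h3 := hchord a t
    rw [ht, ← hw] at h3
    have him : w.im = Real.sin a := by rw [h3]; simp [-Complex.ofReal_sin]
    have harc : Real.arcsin w.im = a := by rw [him, Real.arcsin_sin ha.1 ha.2]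
    simp only [fanCoord, ← hw, harc]

/-- `A` is the weighted X-ray transform `I₀ d^γ`: on (the class of) every square integrable `f` it
is given by the line integrals of `d^γ f`, which converge absolutely for almost every line. -/
def IsWeightedXray (γ : ℝ) (A : L2Disk γ →L[ℂ] L2Fan γ) : Prop :=
  ∀ (f : ℂ → ℂ) (hf : MemLp f 2 (diskMeasure γ)), ∀ᵐ p ∂(fanMeasure γ),
    IntervalIntegrable (fun t => ((dBdf (chord p t) ^ γ : ℝ) : ℂ) * f (chord p t)) volume
      0 (2 * Real.cos p.2) ∧
    A (hf.toLp f) p = xray (fun z => ((dBdf z ^ γ : ℝ) : ℂ) * f z) p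

/-- `B` is the weighted backprojection `I₀^♯ μ^{-2γ-1}`: on (the class of) every square integrable
`g` it is given by the backprojection integral of `μ^{-2γ-1} g`, which converges absolutely for
almost every `z`. -/
def IsWeightedBackproj (γ : ℝ) (B : L2Fan γ →L[ℂ] L2Disk γ) : Prop :=
  ∀ (g : S1 × ℝ → ℂ) (hg : MemLp g 2 (fanMeasure γ)), ∀ᵐ z ∂(diskMeasure γ),
    Integrable (fun θ : S1 =>
      ((muBdf (fanCoord z θ) ^ (-2 * γ - 1) : ℝ) : ℂ) * g (fanCoord z θ)) ∧
    B (hg.toLp g) z = backproj (fun p => ((muBdf p ^ (-2 * γ - 1) : ℝ) : ℂ) * g p) z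

/-- `L n` is an `n`-th orthogonal polynomial (of degree exactly `n`, in any normalization) for the
weight `(1 - x²)^{γ+1/2}` on `[-1, 1]`. -/
structure IsOrthogonalFamily (γ : ℝ) (L : ℕ → Polynomial ℝ) : Prop where
  degree_eq : ∀ n, (L n).degree = n
  orthogonal : ∀ m n, m ≠ n →
    ∫ x in (-1 : ℝ)..1, (L m).eval x * (L n).eval x * (1 - x ^ 2) ^ (γ + 1 / 2) = 0

/-- `ψ_{n,k}^γ = μ^{2γ+1} ((-1)^n / 2π) e^{i(n-2k)(β+α)} L_n^γ(sin α)`. -/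
def psi (γ : ℝ) (L : ℕ → Polynomial ℝ) (n : ℕ) (k : ℤ) (p : S1 × ℝ) : ℂ :=
  ((muBdf p ^ (2 * γ + 1) : ℝ) : ℂ) * ((-1) ^ n / (2 * (π : ℂ))) *
    cis (((n : ℤ) - 2 * k) • (p.1 + (p.2 : S1))) * (((L n).eval (Real.sin p.2) : ℝ) : ℂ)

/-- The antipodal scattering relation `S_A(β,α) = (β + π + 2α, -α)`: reversal of the direction of
a line. -/
def antipodal (p : S1 × ℝ) : S1 × ℝ := (p.1 + ((π + 2 * p.2 : ℝ) : S1), -p.2)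

/-- `g ∘ S_A = g`, i.e. `g` does not depend on the direction of lines. -/
def IsEven (γ : ℝ) (g : L2Fan γ) : Prop := ∀ᵐ p ∂(fanMeasure γ), g (antipodal p) = g p

/-- `g ∘ S_A = -g`. -/
def IsOdd (γ : ℝ) (g : L2Fan γ) : Prop := ∀ᵐ p ∂(fanMeasure γ), g (antipodal p) = -g p

/-- The squared singular value `(σ_{n,k}^γ)²`. -/
def sigmaSq (γ : ℝ) (n k : ℕ) : ℝ :=
  2 ^ (2 * γ + 2) * π * (n.choose k : ℝ) *
    (Real.Gamma (n - k + γ + 1) * Real.Gamma (k + γ + 1) / Real.Gamma (n + 2 * γ + 2))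

/-- The index set `{(n, k) : n ≥ 0, 0 ≤ k ≤ n}`. -/
abbrev Idx : Type := {i : ℕ × ℕ // i.2 ≤ i.1}

/-- `(u_i, v_i, σ_i)` is a singular value decomposition of the operator `A : H → K` with positive
singular values: `(u_i)` and `(v_i)` are complete orthonormal systems and `A u_i = σ_i v_i`. -/
structure IsSVD {ι H K : Type*} [SeminormedAddCommGroup H] [InnerProductSpace ℂ H]
    [SeminormedAddCommGroup K] [InnerProductSpace ℂ K] (A : H →L[ℂ] K)
    (u : ι → H) (v : ι → K) (σ : ι → ℝ) : Prop where
  orthonormal_left : Orthonormal ℂ u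
  complete_left : (Submodule.span ℂ (range u)).topologicalClosure = ⊤
  orthonormal_right : Orthonormal ℂ v
  complete_right : (Submodule.span ℂ (range v)).topologicalClosure = ⊤
  pos : ∀ i, 0 < σ i
  apply_left : ∀ i, A (u i) = (σ i : ℂ) • v i

end XRaySVD

end

/-!
A line is determined by its direction `θ = β + π + α` and its signed distance `sin α` from the
origin, and the point at relative position `u ∈ [-1, 1]` on it is `e^{iθ}(u cos α + i sin α)`, where
`d = cos² α (1 - u²)`. In these coordinates Santaló's formula becomes the statement that
`((β, α), u) ↦ (z, θ)` carries `μ^{2γ+2} dβ dα ⊗ (1 - u²)^γ du` to `d^γ |dz|² ⊗ dθ`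
(`measurePreserving_linePoint`). Since `I₀ d^γ f` is `μ^{2γ+1}` times the integral of `f` against
the finite measure `(1 - u²)^γ du`, and multiplication by `μ^{2γ+1}` is an isometry from
`L²(μ^{2γ+2} dβ dα)` onto `L²(∂₊S𝔻, μ^{-2γ})`, the operator is bounded by the Cauchy–Schwarz
inequality, and Fubini's theorem identifies its adjoint with the weighted backprojection
(`isWeightedBackproj_adjoint`).

The functions `μ^{2γ+1} e^{ip(β+α)} sin^j α` are complete in `L²(∂₊S𝔻, μ^{-2γ})`, and the monomials
`z^a z̄^b` are complete in `L²(𝔻, d^γ)`, by the Stone–Weierstrass theorem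
(`ae_eq_zero_of_forall_integral_mul`). Backprojection maps the former to a nonzero multiple of
`z^{j-k} z̄^k` if `p = j - 2k` with `0 ≤ k ≤ j`, and to zero otherwise (`adjoint_lineVec_X_pow`,
`adjoint_lineVec_X_pow_eq_zero`). The X-ray transform of `z^a z̄^b` is `μ^{2γ+1} e^{i(a-b)(β+α)}`
times a polynomial of degree at most `a + b` in `sin α`, whose top coefficient is a beta integral
(`exists_weightedXray_diskVec`). Hence in each Fourier mode `I₀ d^γ (I₀ d^γ)*` is triangular with
respect to the powers of `sin α`, and its diagonal entries are the `σ²_{n,k}` or zero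
(`exists_weightedXray_adjoint_X_pow`). A symmetric triangular operator is diagonalized by the
orthogonal polynomials (`apply_lineVec_of_triangular`); here the weight `cos^{2γ+2} α dα` is
`(1 - x²)^{γ+1/2} dx` with `x = sin α`, so the `ψ_{n,k}` are eigenvectors with eigenvalue
`σ²_{n,k}`. The same lemma, applied to the reversal of lines, gives the parity `(-1)^{p+n}` of the
modes, so the `ψ_{n,k}` with `k ∈ ℤ` are exactly the even ones.

Everything else is Hilbert space geometry. An even function in the kernel is orthogonal to the
`ψ_{n,k}` with `0 ≤ k ≤ n`, which lie in the range of `I₀ d^γ`; its component orthogonal to the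
remaining `ψ_{n,k}` is thus orthogonal to a complete system (`mem_kernelSpace_iff`). The singular
value decomposition follows from the eigenvectors and the completeness of their backprojections
(`isSVD_of_eigenvectors`).
-/

noncomputable section

namespace XRaySVD

open scoped ComplexConjugate InnerProductSpace

/-! ### The parametrization of lines by a product space -/

lemma continuous_cis : Continuous cis :=
  continuous_subtype_val.comp AddCircle.continuous_toCircle

@[fun_prop] lemma measurable_cis : Measurable cis := continuous_cis.measurable

@[simp] lemma norm_cis (θ : S1) : ‖cis θ‖ = 1 := Circle.norm_coe _

/-- The measure `cos^{2γ+2} α dα` on `[-π/2, π/2]`. -/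
def angleMeasure (γ : ℝ) : Measure ℝ :=
  (volume.restrict (Icc (-(π / 2)) (π / 2))).withDensity
    (fun α => ENNReal.ofReal (Real.cos α ^ (2 * γ + 2)))

/-- The measure `(1 - u²)^γ du` on `[-1, 1]`. -/
def chordMeasure (γ : ℝ) : Measure ℝ :=
  (volume.restrict (Icc (-1) 1)).withDensity (fun u => ENNReal.ofReal ((1 - u ^ 2) ^ γ))

/-- The measure `μ^{2γ+2} dβ dα` on the set of lines. Multiplication by `μ^{2γ+1}` is an isometry
of its `L²` space onto `L²(∂₊S𝔻, μ^{-2γ})`. -/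
def lineMeasure (γ : ℝ) : Measure (S1 × ℝ) := (volume : Measure S1).prod (angleMeasure γ)

/-- The point `u cos α + i sin α` of the disk, on the horizontal chord at height `sin α`. -/
def chordPoint (q : ℝ × ℝ) : ℂ := ⟨Real.cos q.1 * q.2, Real.sin q.1⟩

/-- The point with relative position `u ∈ [-1, 1]` on the chord `p`, and the direction of `p`. -/
def linePoint (q : (S1 × ℝ) × ℝ) : ℂ × S1 :=
  (cis (q.1.1 + ((π + q.1.2 : ℝ) : S1)) * chordPoint (q.1.2, q.2), q.1.1 + ((π + q.1.2 : ℝ) : S1))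

@[fun_prop] lemma measurable_chordPoint : Measurable chordPoint := by
  have : chordPoint = fun q => ((Real.cos q.1 * q.2 : ℝ) : ℂ) + (Real.sin q.1 : ℝ) * Complex.I := by
    ext q; simp [chordPoint, Complex.mk_eq_add_mul_I]
  rw [this]; fun_prop

@[fun_prop] lemma measurable_coe_S1 : Measurable (fun x : ℝ => (x : S1)) :=
  (AddCircle.continuous_mk' (2 * π)).measurable

@[fun_prop] lemma measurable_fanCoord : Measurable (fun q : ℂ × S1 => fanCoord q.1 q.2) := by
  unfold fanCoord
  have h : Measurable fun q : ℂ × S1 => Real.arcsin ((q.1 * cis (-q.2)).im) :=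
    Real.continuous_arcsin.measurable.comp (by fun_prop)
  refine Measurable.prodMk ?_ h
  exact measurable_snd.sub (measurable_coe_S1.comp (h.const_add π))

instance (γ : ℝ) : SFinite (angleMeasure γ) := by unfold angleMeasure; infer_instance
instance (γ : ℝ) : SFinite (chordMeasure γ) := by unfold chordMeasure; infer_instance
instance (γ : ℝ) : SFinite (lineMeasure γ) := by unfold lineMeasure; infer_instance
instance (γ : ℝ) : SFinite (diskMeasure γ) := by unfold diskMeasure; infer_instance
instance (γ : ℝ) : SFinite (fanMeasure γ) := by unfold fanMeasure; infer_instance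

/-- Area of the unit disk by horizontal slices: the chord at height `sin α` has half-length
`cos α`. -/
lemma lintegral_chordPoint {H : ℂ → ℝ≥0∞} (hH : Measurable H) :
    ∫⁻ α in Icc (-(π / 2)) (π / 2), ∫⁻ u in Icc (-1 : ℝ) 1,
      ENNReal.ofReal (Real.cos α ^ 2) * H (chordPoint (α, u)) =
    ∫⁻ z in Metric.closedBall (0 : ℂ) 1, H z := by
  have e1 : ∫⁻ z in Metric.closedBall (0 : ℂ) 1, H z =
      ∫⁻ x in Icc (-1 : ℝ) 1, ∫⁻ y in Icc (-√(1 - x ^ 2)) √(1 - x ^ 2), H ⟨y, x⟩ := by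
    rw [← lintegral_indicator Metric.isClosed_closedBall.measurableSet]
    have hm : Measurable ((Metric.closedBall (0 : ℂ) 1).indicator H) :=
      hH.indicator Metric.isClosed_closedBall.measurableSet
    rw [← (Complex.volume_preserving_equiv_real_prod.symm _).lintegral_comp hm,
      Measure.volume_eq_prod,
      lintegral_prod_symm' (fun a => (Metric.closedBall (0 : ℂ) 1).indicator H
        (Complex.measurableEquivRealProd.symm a))
        (hm.comp Complex.measurableEquivRealProd.symm.measurable),
      ← lintegral_indicator measurableSet_Icc]
    refine lintegral_congr fun x => ?_
    by_cases hx : x ∈ Icc (-1 : ℝ) 1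
    · rw [indicator_of_mem hx, ← lintegral_indicator measurableSet_Icc]
      refine lintegral_congr fun y => ?_
      have : (⟨y, x⟩ : ℂ) ∈ Metric.closedBall (0 : ℂ) 1 ↔ y ∈ Icc (-√(1 - x ^ 2)) √(1 - x ^ 2) := by
        rw [mem_closedBall_zero_iff, mem_Icc, ← abs_le, ← sq_le_one_iff₀ (norm_nonneg _),
          Complex.sq_norm, Complex.normSq_mk]
        have hx' : 0 ≤ 1 - x ^ 2 := by nlinarith [hx.1, hx.2]
        rw [Real.le_sqrt (abs_nonneg _) hx', sq_abs]
        constructor <;> intro h <;> nlinarith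
      by_cases hy : y ∈ Icc (-√(1 - x ^ 2)) √(1 - x ^ 2)
      · rw [indicator_of_mem hy]; exact indicator_of_mem (this.2 hy) _
      · rw [indicator_of_notMem hy]; exact indicator_of_notMem (fun h => hy (this.1 h)) _
    · rw [indicator_of_notMem hx]
      refine lintegral_eq_zero_of_ae_eq_zero (Filter.Eventually.of_forall fun y => ?_)
      refine indicator_of_notMem (fun h => hx ?_) _
      rw [mem_closedBall_zero_iff] at h
      exact abs_le.1 ((Complex.abs_im_le_norm _).trans h)
  have e2 := lintegral_image_eq_lintegral_abs_deriv_mul (s := Icc (-(π / 2)) (π / 2))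
    measurableSet_Icc (fun x _ => (Real.hasDerivAt_sin x).hasDerivWithinAt) Real.injOn_sin
    (fun x => ∫⁻ y in Icc (-√(1 - x ^ 2)) √(1 - x ^ 2), H ⟨y, x⟩)
  rw [Real.bijOn_sin.image_eq] at e2
  rw [e1, e2]
  refine setLIntegral_congr_fun measurableSet_Icc fun α hα => ?_
  have hc : 0 ≤ Real.cos α := Real.cos_nonneg_of_mem_Icc hα
  have hs : √(1 - Real.sin α ^ 2) = Real.cos α := by
    rw [← Real.cos_sq', Real.sqrt_sq hc]
  simp only [hs, abs_of_nonneg hc]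
  have hmH : Measurable fun y : ℝ => H ⟨y, Real.sin α⟩ := by
    refine hH.comp ?_
    have : (fun y : ℝ => (⟨y, Real.sin α⟩ : ℂ)) =
        fun y : ℝ => (y : ℂ) + (Real.sin α : ℝ) * Complex.I := by
      ext y; simp [Complex.mk_eq_add_mul_I]
    rw [this]; fun_prop
  rw [lintegral_const_mul' _ _ ENNReal.ofReal_ne_top, sq, ENNReal.ofReal_mul hc, mul_assoc]
  rcases hc.eq_or_lt with h0 | h0
  · simp [← h0]
  · congr 1
    have e3 := lintegral_image_eq_lintegral_abs_deriv_mul (s := Icc (-1 : ℝ) 1)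
      (f := fun u => Real.cos α * u) (f' := fun _ => Real.cos α) measurableSet_Icc
      (fun x _ => by simpa using ((hasDerivAt_id x).const_mul (Real.cos α)).hasDerivWithinAt)
      (fun x _ y _ h => mul_left_cancel₀ h0.ne' h) (fun y => H ⟨y, Real.sin α⟩)
    rw [Set.image_mul_left_Icc hc (by norm_num)] at e3
    simp only [mul_neg, mul_one, abs_of_nonneg hc] at e3
    rw [e3, lintegral_const_mul' _ _ ENNReal.ofReal_ne_top]
    rfl

lemma dBdf_chordPoint (α u : ℝ) : dBdf (chordPoint (α, u)) = Real.cos α ^ 2 * (1 - u ^ 2) := by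
  rw [dBdf, Complex.sq_norm, chordPoint, Complex.normSq_mk]
  nlinarith [Real.sin_sq_add_cos_sq α]

lemma measurable_dBdf : Measurable dBdf := by unfold dBdf; fun_prop

lemma measurable_diskDensity (γ : ℝ) : Measurable fun z => ENNReal.ofReal (dBdf z ^ γ) :=
  (measurable_dBdf.pow_const γ).ennreal_ofReal

lemma measurable_angleDensity (γ : ℝ) :
    Measurable fun α : ℝ => ENNReal.ofReal (Real.cos α ^ (2 * γ + 2)) :=
  (Real.measurable_cos.pow_const _).ennreal_ofReal

lemma measurable_chordDensity (γ : ℝ) :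
    Measurable fun u : ℝ => ENNReal.ofReal ((1 - u ^ 2) ^ γ) :=
  (Measurable.pow_const (by fun_prop) γ).ennreal_ofReal

lemma measurePreserving_chordPoint (γ : ℝ) (hγ : -1 < γ) :
    MeasurePreserving chordPoint ((angleMeasure γ).prod (chordMeasure γ)) (diskMeasure γ) := by
  refine ⟨measurable_chordPoint, ?_⟩
  refine Measure.ext_of_lintegral _ fun F hF => ?_
  rw [lintegral_map hF measurable_chordPoint, angleMeasure, chordMeasure, diskMeasure,
    prod_withDensity (measurable_angleDensity γ) (measurable_chordDensity γ),
    lintegral_withDensity_eq_lintegral_mul _ (by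
      exact ((measurable_angleDensity γ).comp measurable_fst).mul
        ((measurable_chordDensity γ).comp measurable_snd)) (g := fun a => F (chordPoint a))
      (hF.comp measurable_chordPoint),
    lintegral_withDensity_eq_lintegral_mul _ (measurable_diskDensity γ) hF,
    ← lintegral_chordPoint ((measurable_diskDensity γ).mul hF), lintegral_prod _ (by
      exact ((((measurable_angleDensity γ).comp measurable_fst).mul
        ((measurable_chordDensity γ).comp measurable_snd)).mul
          (hF.comp measurable_chordPoint)).aemeasurable)]
  refine setLIntegral_congr_fun measurableSet_Icc fun α hα => ?_
  refine setLIntegral_congr_fun measurableSet_Icc fun u hu => ?_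
  have hc : 0 ≤ Real.cos α := Real.cos_nonneg_of_mem_Icc hα
  have hu' : 0 ≤ 1 - u ^ 2 := by nlinarith [hu.1, hu.2]
  simp only [Pi.mul_apply]
  rw [← mul_assoc, dBdf_chordPoint, ← ENNReal.ofReal_mul (by positivity),
    ← ENNReal.ofReal_mul (by positivity), Real.mul_rpow (by positivity) hu']
  congr 2
  rw [← mul_assoc]
  congr 1
  rw [← Real.rpow_two, ← Real.rpow_mul hc, ← Real.rpow_add' hc (by linarith)]
  ring_nf

lemma measurePreserving_withDensity {T : Type*} [MeasurableSpace T] {m : Measure T} {f : T → T}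
    (hf : MeasurePreserving f m m) {ρ : T → ℝ≥0∞} (hρ : Measurable ρ) (h : ∀ x, ρ (f x) = ρ x) :
    MeasurePreserving f (m.withDensity ρ) (m.withDensity ρ) := by
  refine ⟨hf.measurable, Measure.ext_of_lintegral _ fun F hF => ?_⟩
  rw [lintegral_map hF hf.measurable,
    lintegral_withDensity_eq_lintegral_mul _ hρ (g := fun x => F (f x)) (hF.comp hf.measurable),
    lintegral_withDensity_eq_lintegral_mul _ hρ hF, ← hf.lintegral_comp (hρ.mul hF)]
  refine lintegral_congr fun x => ?_
  simp [h]

lemma measurePreserving_rotation (γ : ℝ) (θ : S1) :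
    MeasurePreserving (fun z => cis θ * z) (diskMeasure γ) (diskMeasure γ) := by
  have h0 : MeasurePreserving (fun z => cis θ * z) (volume : Measure ℂ) volume :=
    (rotation (AddCircle.toCircle θ)).measurePreserving
  have h1 : MeasurePreserving (fun z => cis θ * z) (volume.restrict (Metric.closedBall (0 : ℂ) 1))
      (volume.restrict (Metric.closedBall (0 : ℂ) 1)) := by
    have := h0.restrict_preimage (s := Metric.closedBall (0 : ℂ) 1)
      Metric.isClosed_closedBall.measurableSet
    convert this using 2
    ext z; simp
  exact measurePreserving_withDensity h1 (measurable_diskDensity γ) fun z => by simp [dBdf]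

/-- Santaló's formula, as a statement about measures. -/
lemma measurePreserving_linePoint (γ : ℝ) (hγ : -1 < γ) :
    MeasurePreserving linePoint ((lineMeasure γ).prod (chordMeasure γ))
      ((diskMeasure γ).prod volume) := by
  have h1 := (measurePreserving_prodAssoc (volume : Measure S1) (angleMeasure γ) (chordMeasure γ))
  have h2 := (Measure.measurePreserving_swap (μ := (volume : Measure S1))
    (ν := (angleMeasure γ).prod (chordMeasure γ))).comp h1
  have h3 := MeasurePreserving.skew_product (μc := (volume : Measure S1)) (μd := volume)
    (measurePreserving_chordPoint γ hγ) (g := fun q β => β + ((π + q.1 : ℝ) : S1))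
    (by unfold Function.uncurry; fun_prop)
    (Filter.Eventually.of_forall fun q =>
      (measurePreserving_add_right (volume : Measure S1) _).map_eq)
  have h4 := MeasurePreserving.skew_product (μc := diskMeasure γ) (μd := diskMeasure γ)
    (MeasurePreserving.id (volume : Measure S1)) (g := fun θ z => cis θ * z)
    (by unfold Function.uncurry; fun_prop)
    (Filter.Eventually.of_forall fun θ => (measurePreserving_rotation γ θ).map_eq)
  exact (Measure.measurePreserving_swap.comp h4).comp
    ((Measure.measurePreserving_swap.comp h3).comp h2)

lemma chord_eq (p : S1 × ℝ) (u : ℝ) :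
    chord p (Real.cos p.2 * (1 + u)) = (linePoint (p, u)).1 := by
  obtain ⟨b, a⟩ := p
  have h : cis b = cis (b + ((π + a : ℝ) : S1)) * (-(Real.cos a : ℂ) + Real.sin a * Complex.I) := by
    have : b = (b + ((π + a : ℝ) : S1)) + ((-(π + a) : ℝ) : S1) := by
      rw [AddCircle.coe_neg]; abel
    conv_lhs => rw [this, cis_add, cis_coe, Complex.exp_mul_I, ← Complex.ofReal_cos,
      ← Complex.ofReal_sin, Real.cos_neg, Real.sin_neg, add_comm π, Real.cos_add_pi,
      Real.sin_add_pi]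
    rw [add_comm a π]
    simp only [Complex.ofReal_neg, neg_neg]
  simp only [chord, linePoint, chordPoint, Complex.mk_eq_add_mul_I]
  conv_lhs => enter [1]; rw [h]
  push_cast
  generalize cis (b + ((π + a : ℝ) : S1)) = w
  ring

lemma norm_linePoint_le {p : S1 × ℝ} {u : ℝ} (hu : u ∈ Icc (-1 : ℝ) 1) :
    ‖(linePoint (p, u)).1‖ ≤ 1 := by
  have h := dBdf_chordPoint p.2 u
  have h1 : 0 ≤ Real.cos p.2 ^ 2 * (1 - u ^ 2) :=
    mul_nonneg (sq_nonneg _) (by nlinarith [hu.1, hu.2])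
  rw [← h, dBdf] at h1
  simp only [linePoint, norm_mul, norm_cis, one_mul]
  exact (sq_le_one_iff₀ (norm_nonneg _)).1 (by linarith)

lemma fanCoord_linePoint {p : S1 × ℝ} (hp : p.2 ∈ Icc (-(π / 2)) (π / 2)) {u : ℝ}
    (hu : u ∈ Icc (-1 : ℝ) 1) : fanCoord (linePoint (p, u)).1 (linePoint (p, u)).2 = p := by
  have hc : 0 ≤ Real.cos p.2 := Real.cos_nonneg_of_mem_Icc hp
  rw [fanCoord_spec (norm_linePoint_le hu)]
  exact ⟨hp, rfl, Real.cos p.2 * (1 + u),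
    ⟨mul_nonneg hc (by linarith [hu.1]), by nlinarith [hu.2]⟩, chord_eq p u⟩

/-! ### The beta integral on `[-1, 1]` and finiteness of the measures -/

lemma betaIntegrand_ofReal (s t : ℝ) {x : ℝ} (hx : x ∈ Icc (0 : ℝ) 1) :
    (x : ℂ) ^ ((s : ℂ) - 1) * (1 - (x : ℂ)) ^ ((t : ℂ) - 1) =
      ((x ^ (s - 1) * (1 - x) ^ (t - 1) : ℝ) : ℂ) := by
  rw [Complex.ofReal_mul, Complex.ofReal_cpow hx.1, Complex.ofReal_cpow (by linarith [hx.2])]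
  push_cast; rfl

lemma intervalIntegrable_beta {s t : ℝ} (hs : 0 < s) (ht : 0 < t) :
    IntervalIntegrable (fun x : ℝ => x ^ (s - 1) * (1 - x) ^ (t - 1)) volume 0 1 := by
  have h := Complex.betaIntegral_convergent (u := s) (v := t) (by simpa) (by simpa)
  rw [intervalIntegrable_iff_integrableOn_Icc_of_le zero_le_one] at h ⊢
  have h2 := (h.congr_fun (fun x hx => betaIntegrand_ofReal s t hx) measurableSet_Icc).re
  simpa [IntegrableOn] using h2

lemma integral_beta {s t : ℝ} (hs : 0 < s) (ht : 0 < t) :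
    ∫ x in (0 : ℝ)..1, x ^ (s - 1) * (1 - x) ^ (t - 1) = ProbabilityTheory.beta s t := by
  rw [ProbabilityTheory.beta_eq_betaIntegralReal s t hs ht, Complex.betaIntegral]
  have : ∫ x in (0 : ℝ)..1, (x : ℂ) ^ ((s : ℂ) - 1) * (1 - (x : ℂ)) ^ ((t : ℂ) - 1) =
      ∫ x in (0 : ℝ)..1, ((x ^ (s - 1) * (1 - x) ^ (t - 1) : ℝ) : ℂ) := by
    refine intervalIntegral.integral_congr fun x hx => ?_
    rw [uIcc_of_le zero_le_one] at hx
    exact betaIntegrand_ofReal s t hx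
  rw [this, intervalIntegral.integral_ofReal, Complex.ofReal_re]

lemma jacobiWeight_eq {s t u : ℝ} (hu : u ∈ Icc (-1 : ℝ) 1) :
    ((1 / 2) * u + 1 / 2) ^ (s - 1) * (1 - ((1 / 2) * u + 1 / 2)) ^ (t - 1) =
      2 ^ (2 - s - t) * ((1 + u) ^ (s - 1) * (1 - u) ^ (t - 1)) := by
  have e1 : (1 / 2) * u + 1 / 2 = 2⁻¹ * (1 + u) := by ring
  have e2 : 1 - ((1 / 2) * u + 1 / 2) = 2⁻¹ * (1 - u) := by ring
  rw [e2, e1, Real.mul_rpow (by norm_num) (by linarith [hu.1]),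
    Real.mul_rpow (by norm_num) (by linarith [hu.2]), Real.inv_rpow (by norm_num),
    Real.inv_rpow (by norm_num), ← Real.rpow_neg (by norm_num), ← Real.rpow_neg (by norm_num),
    mul_mul_mul_comm, ← Real.rpow_add (by norm_num)]
  congr 2; ring

lemma intervalIntegrable_jacobiWeight {s t : ℝ} (hs : 0 < s) (ht : 0 < t) :
    IntervalIntegrable (fun u : ℝ => (1 + u) ^ (s - 1) * (1 - u) ^ (t - 1)) volume (-1) 1 := by
  have h := (intervalIntegrable_beta hs ht).comp_add_right (1 / 2)
  have h' := h.comp_mul_left (c := 1 / 2)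
  norm_num at h'
  have h2 := h'.const_mul ((2 : ℝ) ^ (2 - s - t))⁻¹
  refine h2.congr fun u hu => ?_
  have hu' : u ∈ Icc (-1 : ℝ) 1 := by
    rw [uIoc_of_le (by norm_num)] at hu; exact ⟨hu.1.le, hu.2⟩
  have := jacobiWeight_eq (s := s) (t := t) hu'
  rw [this, inv_mul_cancel_left₀ (by positivity)]

lemma integral_jacobiWeight {s t : ℝ} (hs : 0 < s) (ht : 0 < t) :
    ∫ u in (-1 : ℝ)..1, (1 + u) ^ (s - 1) * (1 - u) ^ (t - 1) =
      2 ^ (s + t - 1) * ProbabilityTheory.beta s t := by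
  have h := intervalIntegral.mul_integral_comp_mul_add (a := -1) (b := 1)
    (f := fun x : ℝ => x ^ (s - 1) * (1 - x) ^ (t - 1)) (1 / 2) (1 / 2)
  have h2 : ∫ u in (-1 : ℝ)..1, ((1 / 2) * u + 1 / 2) ^ (s - 1) *
      (1 - ((1 / 2) * u + 1 / 2)) ^ (t - 1) =
      ∫ u in (-1 : ℝ)..1, 2 ^ (2 - s - t) * ((1 + u) ^ (s - 1) * (1 - u) ^ (t - 1)) := by
    refine intervalIntegral.integral_congr fun u hu => ?_
    rw [uIcc_of_le (by norm_num)] at hu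
    exact jacobiWeight_eq hu
  simp only [h2, intervalIntegral.integral_const_mul] at h
  norm_num at h
  rw [integral_beta hs ht] at h
  rw [← h, ← mul_assoc, ← mul_assoc, mul_right_comm ((2 : ℝ) ^ (s + t - 1)),
    ← Real.rpow_add (by norm_num), show s + t - 1 + (2 - s - t) = 1 by ring]
  norm_num

lemma integrableOn_chordDensity {γ : ℝ} (hγ : -1 < γ) :
    IntegrableOn (fun u : ℝ => (1 - u ^ 2) ^ γ) (Icc (-1) 1) := by
  have h := intervalIntegrable_jacobiWeight (s := γ + 1) (t := γ + 1) (by linarith) (by linarith)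
  rw [intervalIntegrable_iff_integrableOn_Icc_of_le (by norm_num)] at h
  refine h.congr_fun (fun u hu => ?_) measurableSet_Icc
  simp only [add_sub_cancel_right]
  rw [← Real.mul_rpow (by linarith [hu.1]) (by linarith [hu.2])]
  congr 1; ring

variable {γ : ℝ}

instance isFiniteMeasure_chordMeasure [hγ : Fact (-1 < γ)] : IsFiniteMeasure (chordMeasure γ) :=
  isFiniteMeasure_withDensity_ofReal (integrableOn_chordDensity hγ.out).2

lemma cos_rpow_le_one {α s : ℝ} (hα : α ∈ Icc (-(π / 2)) (π / 2)) (hs : 0 ≤ s) :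
    Real.cos α ^ s ≤ 1 :=
  Real.rpow_le_one (Real.cos_nonneg_of_mem_Icc hα) (Real.cos_le_one α) hs

instance isFiniteMeasure_angleMeasure [hγ : Fact (-1 < γ)] : IsFiniteMeasure (angleMeasure γ) := by
  refine isFiniteMeasure_withDensity_ofReal (Integrable.hasFiniteIntegral ?_)
  refine Integrable.mono' (g := fun _ => (1 : ℝ)) (integrable_const _)
    (Real.measurable_cos.pow_const _).aestronglyMeasurable ?_
  filter_upwards [ae_restrict_mem measurableSet_Icc] with α hα
  rw [Real.norm_of_nonneg (Real.rpow_nonneg (Real.cos_nonneg_of_mem_Icc hα) _)]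
  exact cos_rpow_le_one hα (by linarith [hγ.out])

instance isFiniteMeasure_lineMeasure [Fact (-1 < γ)] : IsFiniteMeasure (lineMeasure γ) := by
  unfold lineMeasure; infer_instance

instance isFiniteMeasure_diskMeasure [hγ : Fact (-1 < γ)] : IsFiniteMeasure (diskMeasure γ) := by
  rw [← (measurePreserving_chordPoint γ hγ.out).map_eq]; infer_instance

/-! ### Comparison of the measures on the space of lines -/

/-- The measure `dβ dα` on `𝕊¹ × [-π/2, π/2]`. -/
def flatMeasure : Measure (S1 × ℝ) :=
  (volume : Measure S1).prod (volume.restrict (Icc (-(π / 2)) (π / 2)))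

lemma ae_flatMeasure : ∀ᵐ p ∂flatMeasure, p.2 ∈ Ioo (-(π / 2)) (π / 2) := by
  have h : ∀ᵐ a ∂(volume.restrict (Icc (-(π / 2)) (π / 2))), a ∈ Ioo (-(π / 2)) (π / 2) := by
    rw [← restrict_Ioo_eq_restrict_Icc]
    exact ae_restrict_mem measurableSet_Ioo
  exact Measure.quasiMeasurePreserving_snd.ae h

lemma fanMeasure_eq : fanMeasure γ = flatMeasure.withDensity
    (fun p => ENNReal.ofReal (muBdf p ^ (-2 * γ))) := by
  rw [fanMeasure, flatMeasure, Measure.volume_eq_prod, ← Measure.prod_restrict,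
    Measure.restrict_univ]

lemma lineMeasure_eq : lineMeasure γ = flatMeasure.withDensity
    (fun p => ENNReal.ofReal (muBdf p ^ (2 * γ + 2))) := by
  rw [lineMeasure, flatMeasure, angleMeasure, prod_withDensity_right (measurable_angleDensity γ)]
  rfl

@[fun_prop] lemma measurable_muBdf : Measurable muBdf := by unfold muBdf; fun_prop

lemma measurable_muBdf_rpow (s : ℝ) : Measurable fun p => muBdf p ^ s :=
  measurable_muBdf.pow_const s

lemma muBdf_pos {p : S1 × ℝ} (hp : p.2 ∈ Ioo (-(π / 2)) (π / 2)) : 0 < muBdf p :=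
  Real.cos_pos_of_mem_Ioo hp

lemma ae_withDensity_muBdf (s : ℝ) :
    ae (flatMeasure.withDensity fun p => ENNReal.ofReal (muBdf p ^ s)) = ae flatMeasure := by
  refine le_antisymm (withDensity_absolutelyContinuous _ _).ae_le
    (withDensity_absolutelyContinuous' (measurable_muBdf_rpow s).ennreal_ofReal.aemeasurable
      ?_).ae_le
  filter_upwards [ae_flatMeasure] with p hp
  simpa using Real.rpow_pos_of_pos (muBdf_pos hp) s

lemma ae_fanMeasure : ae (fanMeasure γ) = ae flatMeasure := by
  rw [fanMeasure_eq, ae_withDensity_muBdf]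

lemma ae_lineMeasure : ae (lineMeasure γ) = ae flatMeasure := by
  rw [lineMeasure_eq, ae_withDensity_muBdf]

lemma ae_line_eq_ae_fan : ae (lineMeasure γ) = ae (fanMeasure γ) := by
  rw [ae_fanMeasure, ae_lineMeasure]

lemma ae_fan_mem : ∀ᵐ p ∂(fanMeasure γ), p.2 ∈ Ioo (-(π / 2)) (π / 2) := by
  rw [ae_fanMeasure]; exact ae_flatMeasure

lemma aestronglyMeasurable_fan_iff {φ : S1 × ℝ → ℂ} :
    AEStronglyMeasurable φ (fanMeasure γ) ↔ AEStronglyMeasurable φ (lineMeasure γ) :=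
  ⟨fun h => h.mono_ac (Measure.ae_le_iff_absolutelyContinuous.1 ae_line_eq_ae_fan.le),
    fun h => h.mono_ac (Measure.ae_le_iff_absolutelyContinuous.1 ae_line_eq_ae_fan.ge)⟩

lemma eLpNorm_muBdf_mul (φ : S1 × ℝ → ℂ) :
    eLpNorm (fun p => ((muBdf p ^ (2 * γ + 1) : ℝ) : ℂ) * φ p) 2 (fanMeasure γ) =
      eLpNorm φ 2 (lineMeasure γ) := by
  rw [eLpNorm_eq_lintegral_rpow_enorm_toReal (by norm_num) (by norm_num),
    eLpNorm_eq_lintegral_rpow_enorm_toReal (by norm_num) (by norm_num), fanMeasure_eq,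
    lineMeasure_eq,
    lintegral_withDensity_eq_lintegral_mul_non_measurable _
      (measurable_muBdf_rpow _).ennreal_ofReal (by simp),
    lintegral_withDensity_eq_lintegral_mul_non_measurable _
      (measurable_muBdf_rpow _).ennreal_ofReal (by simp)]
  congr 1
  refine lintegral_congr_ae ?_
  filter_upwards [ae_flatMeasure] with p hp
  have hc := muBdf_pos hp
  simp only [Pi.mul_apply, enorm_mul]
  rw [ENNReal.mul_rpow_of_nonneg _ _ (by simp), ← mul_assoc]
  congr 1
  have : ‖((muBdf p ^ (2 * γ + 1) : ℝ) : ℂ)‖ₑ = ENNReal.ofReal (muBdf p ^ (2 * γ + 1)) := by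
    rw [← ofReal_norm, Complex.norm_real, Real.norm_of_nonneg (by positivity)]
  rw [this, ENNReal.ofReal_rpow_of_nonneg (by positivity) (by simp),
    ← ENNReal.ofReal_mul (by positivity), ← Real.rpow_mul hc.le, ← Real.rpow_add hc]
  congr 2
  simp; ring

lemma memLp_muBdf_mul {φ : S1 × ℝ → ℂ} (hφ : MemLp φ 2 (lineMeasure γ)) :
    MemLp (fun p => ((muBdf p ^ (2 * γ + 1) : ℝ) : ℂ) * φ p) 2 (fanMeasure γ) := by
  refine ⟨?_, by rw [eLpNorm_muBdf_mul]; exact hφ.2⟩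
  exact (Complex.measurable_ofReal.comp
    (measurable_muBdf_rpow _)).aestronglyMeasurable.mul (aestronglyMeasurable_fan_iff.2 hφ.1)

lemma muBdf_mul_cancel (g : S1 × ℝ → ℂ) {p : S1 × ℝ} (hp : p.2 ∈ Ioo (-(π / 2)) (π / 2)) :
    ((muBdf p ^ (2 * γ + 1) : ℝ) : ℂ) * (((muBdf p ^ (-2 * γ - 1) : ℝ) : ℂ) * g p) = g p := by
  rw [← mul_assoc, ← Complex.ofReal_mul, ← Real.rpow_add (muBdf_pos hp)]
  simp

lemma memLp_line_of_memLp_fan {g : S1 × ℝ → ℂ} (hg : MemLp g 2 (fanMeasure γ)) :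
    MemLp (fun p => ((muBdf p ^ (-2 * γ - 1) : ℝ) : ℂ) * g p) 2 (lineMeasure γ) := by
  refine ⟨(Complex.measurable_ofReal.comp (measurable_muBdf_rpow _)).aestronglyMeasurable.mul
    (aestronglyMeasurable_fan_iff.1 hg.1), ?_⟩
  rw [← eLpNorm_muBdf_mul, eLpNorm_congr_ae (g := g)]
  · exact hg.2
  · filter_upwards [ae_fan_mem] with p hp
    exact muBdf_mul_cancel g hp

/-! ### The weighted X-ray transform as an integral over relative positions -/

/-- The integral of `f` along the chord `p`, in the relative position `u ∈ [-1, 1]` and with the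
weight `(1 - u²)^γ`. -/
def chordIntegral (γ : ℝ) (f : ℂ → ℂ) (p : S1 × ℝ) : ℂ :=
  ∫ u, f (linePoint (p, u)).1 ∂(chordMeasure γ)

lemma integrable_chordMeasure_iff {h : ℝ → ℂ} : Integrable h (chordMeasure γ) ↔
    IntervalIntegrable (fun u => (((1 - u ^ 2) ^ γ : ℝ) : ℂ) * h u) volume (-1) 1 := by
  rw [chordMeasure, integrable_withDensity_iff_integrable_smul' (measurable_chordDensity γ)
    (by simp), intervalIntegrable_iff_integrableOn_Icc_of_le (by norm_num)]
  refine integrable_congr ?_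
  filter_upwards [ae_restrict_mem measurableSet_Icc] with u hu
  rw [ENNReal.toReal_ofReal (Real.rpow_nonneg (by nlinarith [hu.1, hu.2]) _), Complex.real_smul]

lemma integral_chordMeasure (h : ℝ → ℂ) : ∫ u, h u ∂(chordMeasure γ) =
    ∫ u in (-1 : ℝ)..1, (((1 - u ^ 2) ^ γ : ℝ) : ℂ) * h u := by
  rw [chordMeasure, integral_withDensity_eq_integral_toReal_smul (measurable_chordDensity γ)
    (by simp), intervalIntegral.integral_of_le (by norm_num), integral_Icc_eq_integral_Ioc]
  refine setIntegral_congr_fun measurableSet_Ioc fun u hu => ?_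
  rw [ENNReal.toReal_ofReal (Real.rpow_nonneg (by nlinarith [hu.1, hu.2]) _), Complex.real_smul]

lemma weight_chord {p : S1 × ℝ} (hp : p.2 ∈ Ioo (-(π / 2)) (π / 2)) {u : ℝ}
    (hu : u ∈ Icc (-1 : ℝ) 1) :
    dBdf (chord p (Real.cos p.2 * u + Real.cos p.2)) ^ γ =
      muBdf p ^ (2 * γ) * (1 - u ^ 2) ^ γ := by
  have hc : 0 < Real.cos p.2 := Real.cos_pos_of_mem_Ioo hp
  have e : Real.cos p.2 * u + Real.cos p.2 = Real.cos p.2 * (1 + u) := by ring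
  have e2 : dBdf (linePoint (p, u)).1 = dBdf (chordPoint (p.2, u)) := by
    simp [dBdf, linePoint]
  rw [e, chord_eq, e2, dBdf_chordPoint, Real.mul_rpow (by positivity) (by nlinarith [hu.1, hu.2]),
    ← Real.rpow_two, ← Real.rpow_mul hc.le, muBdf]

lemma xray_weight_eq (f : ℂ → ℂ) {p : S1 × ℝ} (hp : p.2 ∈ Ioo (-(π / 2)) (π / 2)) :
    xray (fun z => ((dBdf z ^ γ : ℝ) : ℂ) * f z) p =
      ((muBdf p ^ (2 * γ + 1) : ℝ) : ℂ) * chordIntegral γ f p := by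
  have hc : 0 < muBdf p := muBdf_pos hp
  have h := intervalIntegral.smul_integral_comp_mul_add (a := -1) (b := 1)
    (fun t => ((dBdf (chord p t) ^ γ : ℝ) : ℂ) * f (chord p t)) (Real.cos p.2) (Real.cos p.2)
  have e1 : Real.cos p.2 * -1 + Real.cos p.2 = 0 := by ring
  have e2 : Real.cos p.2 * 1 + Real.cos p.2 = 2 * Real.cos p.2 := by ring
  rw [e1, e2] at h
  rw [xray, ← h, chordIntegral, integral_chordMeasure, Real.rpow_add hc, Complex.ofReal_mul,
    Real.rpow_one, mul_right_comm, ← intervalIntegral.integral_const_mul, mul_comm,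
    Complex.real_smul]
  congr 1
  refine intervalIntegral.integral_congr fun u hu => ?_
  rw [uIcc_of_le (by norm_num)] at hu
  have e : Real.cos p.2 * u + Real.cos p.2 = Real.cos p.2 * (1 + u) := by ring
  simp only [weight_chord hp hu]
  rw [e, chord_eq]
  push_cast; ring

lemma intervalIntegrable_weight (f : ℂ → ℂ) {p : S1 × ℝ} (hp : p.2 ∈ Ioo (-(π / 2)) (π / 2))
    (h : Integrable (fun u => f (linePoint (p, u)).1) (chordMeasure γ)) :
    IntervalIntegrable (fun t => ((dBdf (chord p t) ^ γ : ℝ) : ℂ) * f (chord p t)) volume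
      0 (2 * Real.cos p.2) := by
  have hc : 0 < Real.cos p.2 := Real.cos_pos_of_mem_Ioo hp
  rw [integrable_chordMeasure_iff] at h
  have h2 : IntervalIntegrable (fun u => ((dBdf (chord p (Real.cos p.2 * u + Real.cos p.2)) ^ γ : ℝ)
      : ℂ) * f (chord p (Real.cos p.2 * u + Real.cos p.2))) volume (-1) 1 := by
    refine (h.const_mul ((muBdf p ^ (2 * γ) : ℝ) : ℂ)).congr fun u hu => ?_
    rw [uIoc_of_le (by norm_num)] at hu
    have e : Real.cos p.2 * u + Real.cos p.2 = Real.cos p.2 * (1 + u) := by ring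
    simp only [weight_chord hp ⟨hu.1.le, hu.2⟩]
    rw [e, chord_eq]
    push_cast; ring
  have h3 := (IntervalIntegrable.comp_mul_left_iff (f := fun t =>
    ((dBdf (chord p (t + Real.cos p.2)) ^ γ : ℝ) : ℂ) * f (chord p (t + Real.cos p.2)))
    (a := -Real.cos p.2) (b := Real.cos p.2) hc.ne').1 (by
      simpa [neg_div, hc.ne'] using h2)
  have h4 := h3.comp_add_right (-Real.cos p.2)
  simpa [two_mul] using h4

lemma inner_toLp_muBdf_mul {φ ψ : S1 × ℝ → ℂ} (hφ : MemLp φ 2 (lineMeasure γ))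
    (hψ : MemLp ψ 2 (lineMeasure γ)) :
    ⟪(memLp_muBdf_mul hφ).toLp _, (memLp_muBdf_mul hψ).toLp _⟫_ℂ =
      ∫ p, conj (φ p) * ψ p ∂(lineMeasure γ) := by
  rw [L2.inner_def]
  have : (fun p => ⟪(memLp_muBdf_mul hφ).toLp _ p, (memLp_muBdf_mul hψ).toLp _ p⟫_ℂ)
      =ᵐ[fanMeasure γ] fun p => ⟪((muBdf p ^ (2 * γ + 1) : ℝ) : ℂ) * φ p,
        ((muBdf p ^ (2 * γ + 1) : ℝ) : ℂ) * ψ p⟫_ℂ := by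
    filter_upwards [(memLp_muBdf_mul hφ).coeFn_toLp, (memLp_muBdf_mul hψ).coeFn_toLp] with p h1 h2
    rw [h1, h2]
  rw [integral_congr_ae this, fanMeasure_eq, lineMeasure_eq,
    integral_withDensity_eq_integral_toReal_smul (measurable_muBdf_rpow _).ennreal_ofReal (by simp),
    integral_withDensity_eq_integral_toReal_smul (measurable_muBdf_rpow _).ennreal_ofReal (by simp)]
  refine integral_congr_ae ?_
  filter_upwards [ae_flatMeasure] with p hp
  have hc := muBdf_pos hp
  rw [ENNReal.toReal_ofReal (by positivity), ENNReal.toReal_ofReal (by positivity),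
    Complex.real_smul, Complex.real_smul, RCLike.inner_apply, map_mul, Complex.conj_ofReal]
  have : muBdf p ^ (2 * γ + 2) =
      muBdf p ^ (-2 * γ) * (muBdf p ^ (2 * γ + 1) * muBdf p ^ (2 * γ + 1)) := by
    rw [← Real.rpow_add hc, ← Real.rpow_add hc]; congr 1; ring
  rw [this]; push_cast; ring

lemma toLp_eq_muBdf_mul {g : S1 × ℝ → ℂ} (hg : MemLp g 2 (fanMeasure γ)) :
    hg.toLp g = (memLp_muBdf_mul (memLp_line_of_memLp_fan hg)).toLp _ := by
  refine MemLp.toLp_congr _ _ ?_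
  filter_upwards [ae_fan_mem] with p hp
  exact (muBdf_mul_cancel g hp).symm

lemma ae_prod_fanCoord_linePoint : ∀ᵐ q ∂((lineMeasure γ).prod (chordMeasure γ)),
    fanCoord (linePoint q).1 (linePoint q).2 = q.1 := by
  have h1 : ∀ᵐ q : (S1 × ℝ) × ℝ ∂((lineMeasure γ).prod (chordMeasure γ)),
      q.1.2 ∈ Ioo (-(π / 2)) (π / 2) := by
    refine Measure.quasiMeasurePreserving_fst.ae
      (p := fun p : S1 × ℝ => p.2 ∈ Ioo (-(π / 2)) (π / 2)) ?_
    rw [ae_line_eq_ae_fan]; exact ae_fan_mem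
  have h2 : ∀ᵐ q : (S1 × ℝ) × ℝ ∂((lineMeasure γ).prod (chordMeasure γ)), q.2 ∈ Icc (-1 : ℝ) 1 := by
    refine Measure.quasiMeasurePreserving_snd.ae (p := fun u : ℝ => u ∈ Icc (-1 : ℝ) 1) ?_
    exact (withDensity_absolutelyContinuous _ _).ae_le (ae_restrict_mem measurableSet_Icc)
  filter_upwards [h1, h2] with q h1 h2
  exact fanCoord_linePoint (Ioo_subset_Icc_self h1) h2

section Operators

variable [hγ : Fact (-1 < γ)]

lemma measurePreserving_linePoint' :
    MeasurePreserving linePoint ((lineMeasure γ).prod (chordMeasure γ))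
      ((diskMeasure γ).prod volume) := measurePreserving_linePoint γ hγ.out

lemma memLp_comp_linePoint {f : ℂ → ℂ} (hf : MemLp f 2 (diskMeasure γ)) :
    MemLp (fun q => f (linePoint q).1) 2 ((lineMeasure γ).prod (chordMeasure γ)) :=
  (hf.comp_fst (volume : Measure S1)).comp_measurePreserving measurePreserving_linePoint'

lemma eLpNorm_comp_linePoint (f : ℂ → ℂ) (hf : MemLp f 2 (diskMeasure γ)) :
    eLpNorm (fun q => f (linePoint q).1) 2 ((lineMeasure γ).prod (chordMeasure γ)) =
      (volume (univ : Set S1)) ^ (1 / 2 : ℝ) * eLpNorm f 2 (diskMeasure γ) := by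
  have h1 : eLpNorm (fun q => f (linePoint q).1) 2 ((lineMeasure γ).prod (chordMeasure γ)) =
      eLpNorm (fun q => f q.1) 2 ((diskMeasure γ).prod (volume : Measure S1)) :=
    eLpNorm_comp_measurePreserving (hf.comp_fst (volume : Measure S1)).1
      measurePreserving_linePoint'
  have hmap := Measure.map_fst_prod (μ := diskMeasure γ) (ν := (volume : Measure S1))
  have h2 : eLpNorm (fun q => f q.1) 2 ((diskMeasure γ).prod (volume : Measure S1)) =
      eLpNorm f 2 ((volume (univ : Set S1)) • diskMeasure γ) := by
    rw [← hmap]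
    refine (eLpNorm_map_measure ?_ measurable_fst.aemeasurable).symm
    rw [hmap]
    exact hf.1.smul_measure _
  rw [h1, h2, eLpNorm_smul_measure_of_ne_top (by norm_num)]
  simp

/-- Integration over the second factor is bounded on `L²`, by the Cauchy–Schwarz inequality. -/
lemma eLpNorm_integral_prod_le {P U : Type*} [MeasurableSpace P] [MeasurableSpace U]
    (m : Measure P) [SFinite m] (τ : Measure U) [IsFiniteMeasure τ] {h : P × U → ℂ}
    (hh : AEStronglyMeasurable h (m.prod τ)) :
    eLpNorm (fun p => ∫ u, h (p, u) ∂τ) 2 m ≤ τ univ ^ (1 / 2 : ℝ) * eLpNorm h 2 (m.prod τ) := by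
  have key : ∀ᵐ p ∂m, ‖∫ u, h (p, u) ∂τ‖ₑ ^ (2 : ℝ) ≤
      τ univ * ∫⁻ u, ‖h (p, u)‖ₑ ^ (2 : ℝ) ∂τ := by
    filter_upwards [hh.prodMk_left] with p hp
    have h1 := eLpNorm_le_eLpNorm_mul_rpow_measure_univ (p := 1) (q := 2) (by norm_num) hp
    rw [eLpNorm_one_eq_lintegral_enorm, eLpNorm_eq_lintegral_rpow_enorm_toReal (by norm_num)
      (by norm_num)] at h1
    have h2 := (enorm_integral_le_lintegral_enorm (μ := τ) fun u => h (p, u)).trans h1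
    refine (ENNReal.rpow_le_rpow h2 (by norm_num : (0 : ℝ) ≤ 2)).trans (le_of_eq ?_)
    rw [ENNReal.mul_rpow_of_nonneg _ _ (by norm_num), ← ENNReal.rpow_mul, ← ENNReal.rpow_mul]
    norm_num [mul_comm]
  rw [eLpNorm_eq_lintegral_rpow_enorm_toReal (by norm_num) (by norm_num),
    eLpNorm_eq_lintegral_rpow_enorm_toReal (by norm_num) (by norm_num)]
  simp only [ENNReal.toReal_ofNat]
  rw [← ENNReal.mul_rpow_of_nonneg _ _ (by norm_num)]
  refine ENNReal.rpow_le_rpow ?_ (by norm_num)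
  rw [lintegral_prod _ (hh.enorm.pow_const _), ← lintegral_const_mul' _ _ (measure_ne_top _ _)]
  exact lintegral_mono_ae key

lemma memLp_chordIntegral {f : ℂ → ℂ} (hf : MemLp f 2 (diskMeasure γ)) :
    MemLp (chordIntegral γ f) 2 (lineMeasure γ) :=
  ⟨(memLp_comp_linePoint hf).1.integral_prod_right',
    (eLpNorm_integral_prod_le _ _ (memLp_comp_linePoint hf).1).trans_lt
      (ENNReal.mul_lt_top (ENNReal.rpow_lt_top_of_nonneg (by norm_num) (measure_ne_top _ _))
        (memLp_comp_linePoint hf).2)⟩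

lemma quasiMeasurePreserving_linePoint_fst :
    Measure.QuasiMeasurePreserving (fun q => (linePoint q).1)
      ((lineMeasure γ).prod (chordMeasure γ)) (diskMeasure γ) :=
  Measure.quasiMeasurePreserving_fst.comp
    (measurePreserving_linePoint' (γ := γ)).quasiMeasurePreserving

lemma ae_integrable_linePoint {f : ℂ → ℂ} (hf : MemLp f 2 (diskMeasure γ)) :
    ∀ᵐ p ∂(fanMeasure γ), Integrable (fun u => f (linePoint (p, u)).1) (chordMeasure γ) := by
  rw [← ae_line_eq_ae_fan]
  exact ((memLp_comp_linePoint hf).integrable (by norm_num)).prod_right_ae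

lemma chordIntegral_congr_ae {f g : ℂ → ℂ} (h : f =ᵐ[diskMeasure γ] g) :
    chordIntegral γ f =ᵐ[fanMeasure γ] chordIntegral γ g := by
  rw [Filter.EventuallyEq, ← ae_line_eq_ae_fan]
  have := Measure.ae_ae_of_ae_prod
    ((quasiMeasurePreserving_linePoint_fst (γ := γ)).ae h)
  filter_upwards [this] with p hp using integral_congr_ae hp

lemma norm_toLp_chordIntegral_le (f : L2Disk γ) :
    ‖(memLp_muBdf_mul (memLp_chordIntegral (Lp.memLp f))).toLp _‖ ≤
      ((chordMeasure γ univ ^ (1 / 2 : ℝ)).toReal *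
        ((volume (univ : Set S1)) ^ (1 / 2 : ℝ)).toReal) * ‖f‖ := by
  have h1 := eLpNorm_integral_prod_le _ _ (memLp_comp_linePoint (Lp.memLp f)).1
  rw [eLpNorm_comp_linePoint _ (Lp.memLp f), ← mul_assoc] at h1
  rw [Lp.norm_toLp, eLpNorm_muBdf_mul, Lp.norm_def, ← ENNReal.toReal_mul, ← ENNReal.toReal_mul]
  refine ENNReal.toReal_mono (ENNReal.mul_ne_top (ENNReal.mul_ne_top
    (ENNReal.rpow_ne_top_of_nonneg (by norm_num) (measure_ne_top _ _))
    (ENNReal.rpow_ne_top_of_nonneg (by norm_num) (measure_ne_top _ _))) (Lp.eLpNorm_ne_top f)) h1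

/-- The bounded operator `I₀ d^γ`. -/
def weightedXray (γ : ℝ) [hγ : Fact (-1 < γ)] : L2Disk γ →L[ℂ] L2Fan γ :=
  LinearMap.mkContinuous
    { toFun := fun f => (memLp_muBdf_mul (memLp_chordIntegral (Lp.memLp f))).toLp _
      map_add' := fun f g => by
        rw [← MemLp.toLp_add]
        refine MemLp.toLp_congr _ _ ?_
        filter_upwards [chordIntegral_congr_ae (Lp.coeFn_add f g),
          ae_integrable_linePoint (Lp.memLp f), ae_integrable_linePoint (Lp.memLp g)]
          with p h1 h2 h3
        rw [h1, Pi.add_apply, ← mul_add]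
        congr 1
        exact integral_add h2 h3
      map_smul' := fun c f => by
        rw [RingHom.id_apply, ← MemLp.toLp_const_smul]
        refine MemLp.toLp_congr _ _ ?_
        filter_upwards [chordIntegral_congr_ae (Lp.coeFn_smul c f)] with p h1
        rw [h1, Pi.smul_apply, smul_eq_mul, mul_left_comm]
        congr 1
        exact integral_const_mul _ _ }
    _ (fun f => norm_toLp_chordIntegral_le f)

lemma weightedXray_toLp {f : ℂ → ℂ} (hf : MemLp f 2 (diskMeasure γ)) :
    weightedXray γ (hf.toLp f) = (memLp_muBdf_mul (memLp_chordIntegral hf)).toLp _ := by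
  refine MemLp.toLp_congr (memLp_muBdf_mul (memLp_chordIntegral (Lp.memLp (hf.toLp f)))) _ ?_
  filter_upwards [chordIntegral_congr_ae hf.coeFn_toLp] with p hp
  rw [hp]

lemma isWeightedXray_weightedXray : IsWeightedXray γ (weightedXray γ) := by
  intro f hf
  rw [weightedXray_toLp hf]
  filter_upwards [(memLp_muBdf_mul (memLp_chordIntegral hf)).coeFn_toLp, ae_fan_mem,
    ae_integrable_linePoint hf] with p h1 h2 h3
  exact ⟨intervalIntegrable_weight f h2 h3, by rw [h1, xray_weight_eq f h2]⟩

/-! ### The adjoint is the weighted backprojection -/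

lemma integrable_comp_fanCoord {φ : S1 × ℝ → ℂ} (hφ : Integrable φ (lineMeasure γ)) :
    Integrable (fun q : ℂ × S1 => φ (fanCoord q.1 q.2)) ((diskMeasure γ).prod volume) := by
  have hmp := measurePreserving_linePoint' (γ := γ)
  have hq : Measure.QuasiMeasurePreserving (fun q : ℂ × S1 => fanCoord q.1 q.2)
      ((diskMeasure γ).prod volume) (lineMeasure γ) := by
    refine ⟨measurable_fanCoord, ?_⟩
    rw [← hmp.map_eq, Measure.map_map measurable_fanCoord hmp.measurable,
      Measure.map_congr (f := (fun q : ℂ × S1 => fanCoord q.1 q.2) ∘ linePoint) (g := Prod.fst)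
        ae_prod_fanCoord_linePoint]
    exact Measure.quasiMeasurePreserving_fst.absolutelyContinuous
  refine (hmp.integrable_comp (g := fun q : ℂ × S1 => φ (fanCoord q.1 q.2))
    (hφ.1.comp_quasiMeasurePreserving hq)).1 ?_
  refine (hφ.comp_fst (chordMeasure γ)).congr ?_
  filter_upwards [ae_prod_fanCoord_linePoint] with q h
  simp only [Function.comp_apply, h]

lemma isWeightedBackproj_adjoint :
    IsWeightedBackproj γ (ContinuousLinearMap.adjoint (weightedXray γ)) := by
  intro g hg
  set φ : S1 × ℝ → ℂ := fun p => ((muBdf p ^ (-2 * γ - 1) : ℝ) : ℂ) * g p with hφdef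
  have hφ : MemLp φ 2 (lineMeasure γ) := memLp_line_of_memLp_fan hg
  have hφ1 : Integrable φ (lineMeasure γ) := hφ.integrable (by norm_num)
  have hint := integrable_comp_fanCoord hφ1
  have hmp := measurePreserving_linePoint' (γ := γ)
  have hB : ContinuousLinearMap.adjoint (weightedXray γ) (hg.toLp g) =ᵐ[diskMeasure γ]
      backproj φ := by
    refine Integrable.ae_eq_of_forall_setIntegral_eq _ _ ((Lp.memLp _).integrable (by norm_num))
      hint.integral_prod_left fun s hs _ => ?_
    have hs' : diskMeasure γ s ≠ ∞ := measure_ne_top _ _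
    have hS : Integrable (fun q : ℂ × S1 => s.indicator (fun _ => (1 : ℂ)) q.1 *
        φ (fanCoord q.1 q.2)) ((diskMeasure γ).prod volume) := by
      refine (hint.indicator (measurable_fst hs)).congr (Filter.Eventually.of_forall fun q => ?_)
      by_cases hq : q.1 ∈ s <;> simp [hq, indicator]
    have hP : Integrable (fun q => s.indicator (fun _ => (1 : ℂ)) (linePoint q).1 * φ q.1)
        ((lineMeasure γ).prod (chordMeasure γ)) := by
      refine ((hmp.integrable_comp hS.1).2 hS).congr ?_
      filter_upwards [ae_prod_fanCoord_linePoint] with q h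
      simp only [Function.comp_apply, h]
    rw [← L2.inner_indicatorConstLp_one (𝕜 := ℂ) hs hs', ContinuousLinearMap.adjoint_inner_right,
      indicatorConstLp, weightedXray_toLp, toLp_eq_muBdf_mul hg,
      inner_toLp_muBdf_mul
        (memLp_chordIntegral (memLp_indicator_const 2 hs (1 : ℂ) (Or.inr hs'))) hφ]
    calc ∫ p, conj (chordIntegral γ (s.indicator fun _ => 1) p) * φ p ∂(lineMeasure γ)
        = ∫ p, ∫ u, s.indicator (fun _ => (1 : ℂ)) (linePoint (p, u)).1 * φ p ∂(chordMeasure γ)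
            ∂(lineMeasure γ) := by
          refine integral_congr_ae (Filter.Eventually.of_forall fun p => ?_)
          simp only [chordIntegral]
          rw [integral_mul_const, ← integral_conj]
          congr 2
          funext u
          by_cases hq : (linePoint (p, u)).1 ∈ s <;> simp [hq]
      _ = ∫ q, s.indicator (fun _ => (1 : ℂ)) (linePoint q).1 * φ q.1
            ∂((lineMeasure γ).prod (chordMeasure γ)) := (integral_prod _ hP).symm
      _ = ∫ q : ℂ × S1, s.indicator (fun _ => (1 : ℂ)) q.1 * φ (fanCoord q.1 q.2)
            ∂((diskMeasure γ).prod volume) := by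
          rw [← hmp.map_eq, integral_map hmp.measurable.aemeasurable
            (by rw [hmp.map_eq]; exact hS.1)]
          refine integral_congr_ae ?_
          filter_upwards [ae_prod_fanCoord_linePoint] with q h
          simp only [h]
      _ = ∫ z in s, backproj φ z ∂(diskMeasure γ) := by
          rw [integral_prod _ hS, ← integral_indicator hs]
          refine integral_congr_ae (Filter.Eventually.of_forall fun z => ?_)
          by_cases hq : z ∈ s <;> simp [hq, backproj]
  filter_upwards [hB, hint.prod_right_ae] with z h1 h2
  exact ⟨h2, h1⟩

end Operators

/-! ### Completeness by the Stone–Weierstrass theorem -/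

section Completeness

variable {X : Type*} [PseudoEMetricSpace X] [MeasurableSpace X] [BorelSpace X] {m : Measure X}
  {K : Set X}

lemma integrable_continuous_mul_of_compact (hK : IsCompact K) (hmK : ∀ᵐ x ∂m, x ∈ K) {h : X → ℂ}
    (hh : Integrable h m) (φ : C(X, ℂ)) : Integrable (fun x => φ x * h x) m := by
  obtain ⟨C, hC⟩ := hK.exists_bound_of_continuousOn φ.continuous.continuousOn
  exact hh.bdd_mul (c := C) φ.continuous.measurable.aestronglyMeasurable (hmK.mono hC)

/-- Functions on a compact set which are orthogonal to all continuous functions vanish. -/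
lemma ae_eq_zero_of_forall_integral_continuous_mul (hK : IsCompact K) (hmK : ∀ᵐ x ∂m, x ∈ K)
    {h : X → ℂ} (hh : Integrable h m) (h0 : ∀ φ : C(X, ℂ), ∫ x, φ x * h x ∂m = 0) :
    h =ᵐ[m] 0 := by
  refine ae_eq_zero_of_forall_setIntegral_isClosed_eq_zero hh fun s hs => ?_
  have hδ : ∀ n : ℕ, (0 : ℝ) < 1 / ((n : ℝ) + 1) := fun n => by positivity
  have hlim := thickenedIndicator_tendsto_indicator_closure hδ
    tendsto_one_div_add_atTop_nhds_zero_nat s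
  rw [tendsto_pi_nhds] at hlim
  let φ : ℕ → C(X, ℂ) := fun n => ⟨fun x => ((thickenedIndicator (hδ n) s x : ℝ) : ℂ), by
    fun_prop⟩
  have hconv : Filter.Tendsto (fun n => ∫ x, φ n x * h x ∂m) Filter.atTop
      (nhds (∫ x, s.indicator h x ∂m)) := by
    refine tendsto_integral_of_dominated_convergence (fun x => ‖h x‖)
      (fun n => (integrable_continuous_mul_of_compact hK hmK hh (φ n)).1) hh.norm
      (fun n => Filter.Eventually.of_forall fun x => ?_)
      (Filter.Eventually.of_forall fun x => ?_)
    · rw [norm_mul]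
      refine mul_le_of_le_one_left (norm_nonneg _) ?_
      have : ‖φ n x‖ = (thickenedIndicator (hδ n) s x : ℝ) := by
        change ‖((thickenedIndicator (hδ n) s x : ℝ) : ℂ)‖ = _
        rw [Complex.norm_real, Real.norm_of_nonneg (NNReal.coe_nonneg _)]
      rw [this]
      exact_mod_cast thickenedIndicator_le_one (hδ n) s x
    · have h1 := hlim x
      rw [hs.closure_eq] at h1
      have h2 : Filter.Tendsto (fun n => φ n x) Filter.atTop
          (nhds (((s.indicator (fun _ => (1 : NNReal)) x : NNReal) : ℝ) : ℂ)) :=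
        (Complex.continuous_ofReal.tendsto _).comp ((NNReal.continuous_coe.tendsto _).comp h1)
      have h3 := h2.mul_const (h x)
      convert h3 using 2
      by_cases hx : x ∈ s <;> simp [hx]
  rw [integral_indicator hs.measurableSet] at hconv
  refine tendsto_nhds_unique hconv ?_
  simp [h0]

/-- Functions on a compact set `K` which are orthogonal to a self-conjugate multiplicative system of
continuous functions that separates the points of `K` vanish. -/
lemma ae_eq_zero_of_forall_integral_mul (hK : IsCompact K) (hmK : ∀ᵐ x ∂m, x ∈ K)
    (M : Submonoid C(X, ℂ)) (hstar : ∀ φ ∈ M, star φ ∈ M)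
    (hsep : ∀ x ∈ K, ∀ y ∈ K, (∀ φ ∈ M, φ x = φ y) → x = y)
    {h : X → ℂ} (hh : Integrable h m) (h0 : ∀ φ ∈ M, ∫ x, φ x * h x ∂m = 0) : h =ᵐ[m] 0 := by
  have : CompactSpace K := isCompact_iff_compactSpace.1 hK
  let r : C(X, ℂ) →⋆ₐ[ℂ] C(K, ℂ) :=
    ContinuousMap.compStarAlgHom' ℂ ℂ ⟨Subtype.val, continuous_subtype_val⟩
  let S : StarSubalgebra ℂ C(K, ℂ) := StarAlgebra.adjoin ℂ (r '' M)
  have hS : S.topologicalClosure = ⊤ := by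
    refine ContinuousMap.starSubalgebra_topologicalClosure_eq_top_of_separatesPoints S ?_
    intro x y hxy
    by_contra hcon
    push Not at hcon
    refine hxy (Subtype.ext (hsep x x.2 y y.2 fun φ hφ => ?_))
    exact hcon _ ⟨r φ, StarAlgebra.subset_adjoin ℂ _ ⟨φ, hφ, rfl⟩, rfl⟩
  have hspan : ∀ F ∈ S, ∃ s ∈ Submodule.span ℂ (M : Set C(X, ℂ)), r s = F := by
    intro F hF
    have h1 : F ∈ Subalgebra.toSubmodule S.toSubalgebra := hF
    rw [StarAlgebra.adjoin_eq_span] at h1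
    have h2 : (r '' M ∪ star (r '' M)) ⊆ (M.map r : Set C(K, ℂ)) := by
      rintro G (⟨φ, hφ, rfl⟩ | ⟨φ, hφ, hG⟩)
      · exact ⟨φ, hφ, rfl⟩
      · exact ⟨star φ, hstar φ hφ, by rw [map_star]; exact (congrArg star hG).trans (star_star G)⟩
    have h3 := Submodule.span_mono ((Submonoid.closure_le (S := M.map r)).2 h2) h1
    have h4 : ((M.map r : Submonoid C(K, ℂ)) : Set C(K, ℂ)) =
        (r.toAlgHom.toLinearMap : C(X, ℂ) →ₗ[ℂ] C(K, ℂ)) '' M := rfl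
    rw [h4, Submodule.span_image] at h3
    exact h3
  have hzero : ∀ s ∈ Submodule.span ℂ (M : Set C(X, ℂ)), ∫ x, s x * h x ∂m = 0 := by
    intro s hs
    induction hs using Submodule.span_induction with
    | mem φ hφ => exact h0 φ hφ
    | zero => simp
    | add a b _ _ ha hb =>
      simp only [ContinuousMap.add_apply, add_mul]
      rw [integral_add (integrable_continuous_mul_of_compact hK hmK hh a)
        (integrable_continuous_mul_of_compact hK hmK hh b), ha, hb, add_zero]
    | smul c a _ ha =>
      simp only [ContinuousMap.smul_apply, smul_eq_mul, mul_assoc]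
      rw [integral_const_mul, ha, mul_zero]
  refine ae_eq_zero_of_forall_integral_continuous_mul hK hmK hh fun φ => ?_
  have hbound : ∀ ε > 0, ‖∫ x, φ x * h x ∂m‖ ≤ ε * ∫ x, ‖h x‖ ∂m := by
    intro ε hε
    have h1 : r φ ∈ closure (S : Set C(K, ℂ)) := by
      rw [← StarSubalgebra.topologicalClosure_coe, hS]; trivial
    obtain ⟨F, hF, hd⟩ := Metric.mem_closure_iff.1 h1 ε hε
    obtain ⟨s, hs, rfl⟩ := hspan F hF
    have h2 : ∫ x, φ x * h x ∂m = ∫ x, (φ x - s x) * h x ∂m := by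
      simp only [sub_mul]
      rw [integral_sub (integrable_continuous_mul_of_compact hK hmK hh φ)
        (integrable_continuous_mul_of_compact hK hmK hh s), hzero s hs, sub_zero]
    rw [h2, ← integral_const_mul]
    refine norm_integral_le_of_norm_le (hh.norm.const_mul ε) ?_
    filter_upwards [hmK] with x hx
    rw [norm_mul]
    refine mul_le_mul_of_nonneg_right ?_ (norm_nonneg _)
    have := (ContinuousMap.dist_apply_le_dist (f := r φ) (g := r s) ⟨x, hx⟩).trans hd.le
    rwa [dist_eq_norm] at this
  have hle : ‖∫ x, φ x * h x ∂m‖ ≤ 0 := by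
    refine ge_of_tendsto (x := nhdsWithin (0 : ℝ) (Ioi 0))
      (f := fun ε => ε * ∫ x, ‖h x‖ ∂m) ?_ (by
        filter_upwards [self_mem_nhdsWithin] with ε hε using hbound ε hε)
    have : Filter.Tendsto (fun ε : ℝ => ε * ∫ x, ‖h x‖ ∂m) (nhds 0) (nhds (0 * ∫ x, ‖h x‖ ∂m)) :=
      Filter.tendsto_id.mul_const _
    rw [zero_mul] at this
    exact this.mono_left nhdsWithin_le_nhds
  simpa using hle

end Completeness

open Polynomial (X C)

/-! ### Characters of the circle -/

lemma cis_zsmul (n : ℤ) (θ : S1) : cis (n • θ) = cis θ ^ n := by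
  simp [cis, AddCircle.toCircle_zsmul]

lemma cis_ne_zero (θ : S1) : cis θ ≠ 0 := by
  rw [← norm_ne_zero_iff, norm_cis]; exact one_ne_zero

lemma cis_neg (θ : S1) : cis (-θ) = (cis θ)⁻¹ :=
  eq_inv_of_mul_eq_one_right (cis_mul_neg θ)

lemma conj_cis (θ : S1) : conj (cis θ) = (cis θ)⁻¹ := by
  rw [← cis_neg, cis, cis, ← Circle.coe_inv_eq_conj, AddCircle.toCircle_neg]

lemma cis_coe_pi : cis ((π : ℝ) : S1) = -1 := by
  rw [cis_coe, Complex.exp_pi_mul_I]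

lemma volume_real_S1 : (volume : Measure S1).real univ = 2 * π := by
  rw [Measure.real, AddCircle.measure_univ, ENNReal.toReal_ofReal Real.two_pi_pos.le]

lemma integral_cis_zpow (m : ℤ) : ∫ θ : S1, cis θ ^ m = if m = 0 then (2 * π : ℂ) else 0 := by
  split_ifs with h
  · subst h
    simp only [zpow_zero, integral_const, volume_real_S1, Complex.real_smul, mul_one]
    push_cast; rfl
  · -- the translation by half a period of `e^{imθ}` changes its sign
    refine integral_eq_zero_of_add_right_eq_neg (g := ((2 * π / 2 / m : ℝ) : S1)) fun θ => ?_
    have := fourier_add_half_inv_index (T := 2 * π) h Real.two_pi_pos θ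
    rw [fourier_apply, fourier_apply] at this
    rw [← cis_zsmul, ← cis_zsmul]
    exact this

/-! ### Weighted polynomial functions on the space of lines -/

/-- The function `e^{ip(β+α)} Q(sin α)` on the space of lines. -/
def lineFun (p : ℤ) (Q : Polynomial ℂ) (q : S1 × ℝ) : ℂ :=
  cis (q.1 + (q.2 : S1)) ^ p * Q.eval ((Real.sin q.2 : ℝ) : ℂ)

lemma continuous_lineFun (p : ℤ) (Q : Polynomial ℂ) : Continuous (lineFun p Q) := by
  have h1 : Continuous fun q : S1 × ℝ => cis (q.1 + (q.2 : S1)) :=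
    continuous_cis.comp (continuous_fst.add ((AddCircle.continuous_mk' _).comp continuous_snd))
  have h2 : Continuous fun q : S1 × ℝ => Q.eval ((Real.sin q.2 : ℝ) : ℂ) :=
    Q.continuous.comp (by fun_prop)
  exact (h1.zpow₀ p fun q => Or.inl (cis_ne_zero _)).mul h2

lemma lineFun_X_pow (p : ℤ) (j : ℕ) (q : S1 × ℝ) :
    lineFun p (X ^ j) q = cis (q.1 + (q.2 : S1)) ^ p * ((Real.sin q.2 : ℝ) : ℂ) ^ j := by
  rw [lineFun, Polynomial.eval_pow, Polynomial.eval_X]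

lemma conj_lineFun_X_pow (p : ℤ) (j : ℕ) (q : S1 × ℝ) :
    conj (lineFun p (X ^ j) q) = lineFun (-p) (X ^ j) q := by
  rw [lineFun_X_pow, lineFun_X_pow, map_mul, map_zpow₀, conj_cis, map_pow, Complex.conj_ofReal,
    inv_zpow, zpow_neg]

/-- The multiplicative system of the functions `e^{ip(β+α)} sin^j α`. -/
def trigMonomials : Submonoid C(S1 × ℝ, ℂ) where
  carrier := {φ | ∃ (p : ℤ) (j : ℕ), φ = ⟨lineFun p (X ^ j), continuous_lineFun _ _⟩}
  one_mem' := ⟨0, 0, by ext q; simp [lineFun]⟩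
  mul_mem' := by
    rintro _ _ ⟨p, j, rfl⟩ ⟨p', j', rfl⟩
    refine ⟨p + p', j + j', ?_⟩
    ext q
    simp only [ContinuousMap.mul_apply, ContinuousMap.coe_mk, lineFun_X_pow,
      zpow_add₀ (cis_ne_zero _)]
    ring

lemma star_mem_trigMonomials : ∀ φ ∈ trigMonomials, star φ ∈ trigMonomials := by
  rintro _ ⟨p, j, rfl⟩
  exact ⟨-p, j, by ext q; exact conj_lineFun_X_pow p j q⟩

lemma separates_trigMonomials : ∀ x ∈ (univ : Set S1) ×ˢ Icc (-(π / 2)) (π / 2),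
    ∀ y ∈ (univ : Set S1) ×ˢ Icc (-(π / 2)) (π / 2),
      (∀ φ ∈ trigMonomials, φ x = φ y) → x = y := by
  rintro ⟨b, a⟩ ⟨-, ha⟩ ⟨b', a'⟩ ⟨-, ha'⟩ hM
  have h1 : lineFun 0 (X ^ 1) (b, a) = lineFun 0 (X ^ 1) (b', a') := hM _ ⟨0, 1, rfl⟩
  have h2 : lineFun 1 (X ^ 0) (b, a) = lineFun 1 (X ^ 0) (b', a') := hM _ ⟨1, 0, rfl⟩
  rw [lineFun_X_pow, lineFun_X_pow] at h1 h2
  simp only [zpow_zero, pow_one, one_mul, Complex.ofReal_inj] at h1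
  have haa : a = a' := Real.injOn_sin ha ha' h1
  subst haa
  simp only [zpow_one, pow_zero, mul_one] at h2
  have h3 := AddCircle.injective_toCircle Real.two_pi_pos.ne' (Subtype.ext h2)
  rw [add_right_cancel h3]

lemma isCompact_lines : IsCompact ((univ : Set S1) ×ˢ Icc (-(π / 2)) (π / 2)) :=
  isCompact_univ.prod isCompact_Icc

lemma ae_line_mem : ∀ᵐ q ∂(lineMeasure γ), q ∈ (univ : Set S1) ×ˢ Icc (-(π / 2)) (π / 2) := by
  rw [ae_line_eq_ae_fan]
  filter_upwards [ae_fan_mem] with q hq using ⟨trivial, Ioo_subset_Icc_self hq⟩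

lemma exists_eq_toLp_muBdf_mul (h : L2Fan γ) :
    ∃ (φ : S1 × ℝ → ℂ) (hφ : MemLp φ 2 (lineMeasure γ)), h = (memLp_muBdf_mul hφ).toLp _ := by
  refine ⟨_, memLp_line_of_memLp_fan (Lp.memLp h), ?_⟩
  rw [← toLp_eq_muBdf_mul (Lp.memLp h), Lp.toLp_coeFn]

section

variable [hγ : Fact (-1 < γ)]

lemma memLp_lineFun (p : ℤ) (Q : Polynomial ℂ) : MemLp (lineFun p Q) 2 (lineMeasure γ) := by
  obtain ⟨C, hC⟩ := isCompact_lines.exists_bound_of_continuousOn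
    (continuous_lineFun p Q).continuousOn
  exact MemLp.of_bound (continuous_lineFun p Q).measurable.aestronglyMeasurable C
    (ae_line_mem.mono hC)

/-- The function `μ^{2γ+1} e^{ip(β+α)} Q(sin α)` as an element of `L²(∂₊S𝔻, μ^{-2γ})`, linearly in
the polynomial `Q`. -/
def lineVec (γ : ℝ) [hγ : Fact (-1 < γ)] (p : ℤ) : Polynomial ℂ →ₗ[ℂ] L2Fan γ where
  toFun Q := (memLp_muBdf_mul (memLp_lineFun p Q)).toLp _
  map_add' Q R := by
    rw [← MemLp.toLp_add]
    refine MemLp.toLp_congr _ _ (Filter.Eventually.of_forall fun q => ?_)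
    simp only [lineFun, Pi.add_apply, Polynomial.eval_add]; ring
  map_smul' c Q := by
    rw [RingHom.id_apply, ← MemLp.toLp_const_smul]
    refine MemLp.toLp_congr _ _ (Filter.Eventually.of_forall fun q => ?_)
    simp only [lineFun, Pi.smul_apply, Polynomial.eval_smul, smul_eq_mul]; ring

lemma lineVec_apply (p : ℤ) (Q : Polynomial ℂ) :
    lineVec γ p Q = (memLp_muBdf_mul (memLp_lineFun p Q)).toLp _ := rfl

lemma inner_lineVec (p q : ℤ) (Q R : Polynomial ℂ) :
    ⟪lineVec γ p Q, lineVec γ q R⟫_ℂ =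
      (if p = q then (2 * π : ℂ) else 0) *
        ∫ α, conj (Q.eval ((Real.sin α : ℝ) : ℂ)) * R.eval ((Real.sin α : ℝ) : ℂ)
          ∂(angleMeasure γ) := by
  rw [lineVec_apply, lineVec_apply,
    inner_toLp_muBdf_mul (memLp_lineFun _ _) (memLp_lineFun _ _), lineMeasure, integral_prod_symm]
  · have : ∀ α : ℝ, ∫ β : S1, conj (lineFun p Q (β, α)) * lineFun q R (β, α) =
        (if p = q then (2 * π : ℂ) else 0) *
          (conj (Q.eval ((Real.sin α : ℝ) : ℂ)) * R.eval ((Real.sin α : ℝ) : ℂ)) := by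
      intro α
      have h1 : ∀ β : S1, conj (lineFun p Q (β, α)) * lineFun q R (β, α) =
          cis (β + (α : S1)) ^ (q - p) *
          (conj (Q.eval ((Real.sin α : ℝ) : ℂ)) * R.eval ((Real.sin α : ℝ) : ℂ)) := by
        intro β
        simp only [lineFun, map_mul, map_zpow₀, conj_cis]
        rw [zpow_sub₀ (cis_ne_zero _), inv_zpow]
        ring
      simp only [h1]
      rw [integral_mul_const, integral_add_right_eq_self (fun β : S1 => cis β ^ (q - p)),
        integral_cis_zpow]
      simp only [sub_eq_zero, eq_comm]
    simp only [this]
    rw [integral_const_mul]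
  · exact ((memLp_lineFun q R).integrable_mul (memLp_lineFun p Q).star).congr
      (Filter.Eventually.of_forall fun x => mul_comm _ _)

/-- The monomials `e^{ip(β+α)} sin^j α`, with the weight `μ^{2γ+1}`, are complete. -/
lemma eq_zero_of_forall_inner_lineVec (h : L2Fan γ)
    (h0 : ∀ (p : ℤ) (j : ℕ), ⟪lineVec γ p (X ^ j), h⟫_ℂ = 0) : h = 0 := by
  obtain ⟨φ, hφ, rfl⟩ := exists_eq_toLp_muBdf_mul h
  have h1 : ∀ ψ ∈ trigMonomials, ∫ q, ψ q * φ q ∂(lineMeasure γ) = 0 := by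
    rintro _ ⟨p, j, rfl⟩
    have h1 := h0 (-p) j
    rw [lineVec_apply, inner_toLp_muBdf_mul (memLp_lineFun _ _) hφ] at h1
    simp only [conj_lineFun_X_pow, neg_neg] at h1
    exact h1
  have hz := ae_eq_zero_of_forall_integral_mul isCompact_lines (ae_line_mem (γ := γ))
    trigMonomials star_mem_trigMonomials separates_trigMonomials (hφ.integrable (by norm_num)) h1
  rw [Filter.EventuallyEq, ae_line_eq_ae_fan] at hz
  rw [Lp.eq_zero_iff_ae_eq_zero]
  filter_upwards [hz, (memLp_muBdf_mul hφ).coeFn_toLp] with q hq hq2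
  rw [hq2, hq]; simp

/-! ### Monomials on the disk -/

lemma memLp_diskMonomial (a b : ℕ) :
    MemLp (fun z : ℂ => z ^ a * conj z ^ b) 2 (diskMeasure γ) := by
  refine MemLp.of_bound (Continuous.aestronglyMeasurable (by fun_prop)) 1 ?_
  have h : ∀ᵐ z ∂(diskMeasure γ), z ∈ Metric.closedBall (0 : ℂ) 1 :=
    (withDensity_absolutelyContinuous _ _).ae_le
      (ae_restrict_mem Metric.isClosed_closedBall.measurableSet)
  filter_upwards [h] with z hz
  rw [mem_closedBall_zero_iff] at hz
  rw [norm_mul, norm_pow, norm_pow, RCLike.norm_conj]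
  exact mul_le_one₀ (pow_le_one₀ (norm_nonneg _) hz) (by positivity)
    (pow_le_one₀ (norm_nonneg _) hz)

/-- The monomial `z^a z̄^b` in `L²(𝔻, d^γ)`. -/
def diskVec (γ : ℝ) [hγ : Fact (-1 < γ)] (a b : ℕ) : L2Disk γ :=
  (memLp_diskMonomial a b).toLp _

lemma eq_zero_of_forall_inner_diskVec (f : L2Disk γ)
    (h0 : ∀ a b : ℕ, ⟪diskVec γ a b, f⟫_ℂ = 0) : f = 0 := by
  have h : ∀ᵐ z ∂(diskMeasure γ), z ∈ Metric.closedBall (0 : ℂ) 1 :=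
    (withDensity_absolutelyContinuous _ _).ae_le
      (ae_restrict_mem Metric.isClosed_closedBall.measurableSet)
  have hz := ae_eq_zero_of_forall_integral_mul (isCompact_closedBall (0 : ℂ) 1) h
    { carrier := {φ | ∃ a b : ℕ, φ = ⟨fun z => z ^ a * conj z ^ b, by fun_prop⟩}
      one_mem' := ⟨0, 0, by ext q; simp⟩
      mul_mem' := by
        rintro _ _ ⟨a, b, rfl⟩ ⟨a', b', rfl⟩
        refine ⟨a + a', b + b', ?_⟩
        ext z
        simp only [ContinuousMap.mul_apply, ContinuousMap.coe_mk, pow_add]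
        ring }
    (by
      rintro _ ⟨a, b, rfl⟩
      refine ⟨b, a, ?_⟩
      ext z
      simp [mul_comm])
    (by
      intro x _ y _ hM
      have := hM _ ⟨1, 0, rfl⟩
      simpa using this)
    ((Lp.memLp f).integrable (by norm_num))
    (by
      rintro _ ⟨a, b, rfl⟩
      have h1 := h0 b a
      rw [L2.inner_def] at h1
      rw [← h1]
      refine integral_congr_ae ?_
      filter_upwards [(memLp_diskMonomial (γ := γ) b a).coeFn_toLp] with z hz
      rw [diskVec, hz, RCLike.inner_apply]
      simp [mul_comm])
  exact (Lp.eq_zero_iff_ae_eq_zero).2 hz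

end

/-! ### Backprojection of monomials -/

lemma ae_disk_norm_lt : ∀ᵐ z ∂(diskMeasure γ), ‖z‖ < 1 := by
  refine (withDensity_absolutelyContinuous _ _).ae_le ?_
  have h1 : ∀ᵐ z ∂(volume : Measure ℂ), z ∉ Metric.sphere (0 : ℂ) 1 :=
    measure_eq_zero_iff_ae_notMem.1 (Measure.addHaar_sphere volume (0 : ℂ) 1)
  filter_upwards [ae_restrict_of_ae h1,
    ae_restrict_mem Metric.isClosed_closedBall.measurableSet] with z h2 h3
  rw [mem_closedBall_zero_iff] at h3
  rw [mem_sphere_zero_iff_norm] at h2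
  exact lt_of_le_of_ne h3 h2

lemma lineFun_fanCoord (p : ℤ) (Q : Polynomial ℂ) {z : ℂ} (hz : ‖z‖ < 1) (θ : S1) :
    lineFun p Q (fanCoord z θ) =
      (-1) ^ p * cis θ ^ p * Q.eval (((z * cis (-θ)).im : ℝ) : ℂ) := by
  have hw : |(z * cis (-θ)).im| ≤ 1 :=
    (Complex.abs_im_le_norm _).trans (by rw [norm_mul, norm_cis, mul_one]; exact hz.le)
  simp only [lineFun, fanCoord]
  rw [Real.sin_arcsin (abs_le.1 hw).1 (abs_le.1 hw).2]
  congr 1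
  rw [← mul_zpow, AddCircle.coe_add, sub_add_eq_add_sub, add_sub_add_right_eq_sub, sub_eq_add_neg,
    cis_add, cis_neg, cis_coe_pi, mul_comm]
  norm_num

lemma muBdf_fanCoord_pos {z : ℂ} (hz : ‖z‖ < 1) (θ : S1) : 0 < muBdf (fanCoord z θ) := by
  have hw : |(z * cis (-θ)).im| < 1 :=
    (Complex.abs_im_le_norm _).trans_lt (by rw [norm_mul, norm_cis, mul_one]; exact hz)
  exact Real.cos_pos_of_mem_Ioo
    ⟨Real.neg_pi_div_two_lt_arcsin.2 (abs_lt.1 hw).1, Real.arcsin_lt_pi_div_two.2 (abs_lt.1 hw).2⟩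

lemma integrable_cis_zpow (m : ℤ) : Integrable fun θ : S1 => cis θ ^ m := by
  refine Continuous.integrable_of_hasCompactSupport ?_ (HasCompactSupport.of_compactSpace _)
  exact continuous_cis.zpow₀ m fun θ => Or.inl (cis_ne_zero θ)

lemma integral_cis_mul_im_pow (p : ℤ) (j : ℕ) (z : ℂ) :
    ∫ θ : S1, (-1) ^ p * cis θ ^ p * (((z * cis (-θ)).im : ℝ) : ℂ) ^ j =
      ∑ m ∈ Finset.range (j + 1), ((-1) ^ p * (2 * Complex.I)⁻¹ ^ j * (j.choose m : ℂ) *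
        (z ^ m * (-conj z) ^ (j - m))) * (if p + j - 2 * m = 0 then (2 * π : ℂ) else 0) := by
  have h : ∀ θ : S1, (-1) ^ p * cis θ ^ p * (((z * cis (-θ)).im : ℝ) : ℂ) ^ j =
      ∑ m ∈ Finset.range (j + 1), ((-1) ^ p * (2 * Complex.I)⁻¹ ^ j * (j.choose m : ℂ) *
        (z ^ m * (-conj z) ^ (j - m))) * cis θ ^ (p + j - 2 * m) := by
    intro θ
    have hw := cis_ne_zero θ
    have e : (((z * cis (-θ)).im : ℝ) : ℂ) =
        (2 * Complex.I)⁻¹ * (z * (cis θ)⁻¹ + -conj z * cis θ) := by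
      rw [Complex.im_eq_sub_conj, map_mul, cis_neg, map_inv₀, conj_cis, inv_inv]
      field_simp
      ring
    rw [e, mul_pow, add_pow, Finset.mul_sum, Finset.mul_sum]
    refine Finset.sum_congr rfl fun m hm => ?_
    have hm' : m ≤ j := Nat.lt_succ_iff.1 (Finset.mem_range.1 hm)
    have e2 : cis θ ^ (p + j - 2 * m) = cis θ ^ p * ((cis θ)⁻¹ ^ m * cis θ ^ (j - m)) := by
      have : p + (j : ℤ) - 2 * m = p + (-(m : ℤ) + ((j - m : ℕ) : ℤ)) := by
        push_cast [hm']; ring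
      rw [this, zpow_add₀ hw, zpow_add₀ hw, zpow_neg, zpow_natCast, zpow_natCast, inv_pow]
    rw [e2, mul_pow, mul_pow]
    ring
  simp only [h]
  rw [integral_finsetSum _ fun m _ => (integrable_cis_zpow _).const_mul _]
  refine Finset.sum_congr rfl fun m _ => ?_
  rw [integral_const_mul, integral_cis_zpow]

section

variable [hγ : Fact (-1 < γ)]

lemma adjoint_lineVec_ae (p : ℤ) (Q : Polynomial ℂ) :
    ContinuousLinearMap.adjoint (weightedXray γ) (lineVec γ p Q) =ᵐ[diskMeasure γ]
      fun z => ∫ θ : S1, (-1) ^ p * cis θ ^ p * Q.eval (((z * cis (-θ)).im : ℝ) : ℂ) := by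
  filter_upwards [isWeightedBackproj_adjoint (γ := γ) _ (memLp_muBdf_mul (memLp_lineFun p Q)),
    ae_disk_norm_lt] with z h1 h2
  rw [lineVec_apply, h1.2, backproj]
  refine integral_congr_ae (Filter.Eventually.of_forall fun θ => ?_)
  simp only
  rw [← mul_assoc, ← Complex.ofReal_mul, ← Real.rpow_add (muBdf_fanCoord_pos h2 θ),
    lineFun_fanCoord p Q h2 θ]
  simp

/-- The backprojection of `μ^{2γ+1} e^{i(j-2k)(β+α)} sin^j α` is a multiple of `z^{j-k} z̄^k`. -/
lemma adjoint_lineVec_X_pow {j k : ℕ} (hk : k ≤ j) :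
    ContinuousLinearMap.adjoint (weightedXray γ) (lineVec γ ((j : ℤ) - 2 * k) (X ^ j)) =
      (2 * π * (-1) ^ j * (-1) ^ k * (2 * Complex.I)⁻¹ ^ j * (j.choose k : ℂ)) •
        diskVec γ (j - k) k := by
  refine Lp.ext ?_
  filter_upwards [adjoint_lineVec_ae ((j : ℤ) - 2 * k) (X ^ j), Lp.coeFn_smul (2 * π * (-1) ^ j *
    (-1) ^ k * (2 * Complex.I)⁻¹ ^ j * (j.choose k : ℂ)) (diskVec γ (j - k) k),
    (memLp_diskMonomial (γ := γ) (j - k) k).coeFn_toLp] with z h1 h2 h3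
  rw [h1, h2, Pi.smul_apply, diskVec, h3]
  simp only [Polynomial.eval_pow, Polynomial.eval_X]
  rw [integral_cis_mul_im_pow, Finset.sum_eq_single (j - k)]
  · have e : (j : ℤ) - 2 * k + j - 2 * ((j - k : ℕ) : ℤ) = 0 := by push_cast [hk]; ring
    have e2 : (-1 : ℂ) ^ ((j : ℤ) - 2 * k) = (-1) ^ j := by
      rw [zpow_sub₀ (by norm_num), zpow_mul]; norm_num
    rw [if_pos e, e2, Nat.sub_sub_self hk, Nat.choose_symm hk, neg_pow, smul_eq_mul]
    ring
  · intro m hm hne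
    have hm' : m ≤ j := Nat.lt_succ_iff.1 (Finset.mem_range.1 hm)
    rw [if_neg, mul_zero]
    omega
  · intro h
    exact absurd (Finset.mem_range.2 (by omega)) h

/-- All other monomials are mapped to zero by backprojection. -/
lemma adjoint_lineVec_X_pow_eq_zero {p : ℤ} {j : ℕ} (hp : ∀ k ≤ j, p ≠ (j : ℤ) - 2 * k) :
    ContinuousLinearMap.adjoint (weightedXray γ) (lineVec γ p (X ^ j)) = 0 := by
  rw [Lp.eq_zero_iff_ae_eq_zero]
  filter_upwards [adjoint_lineVec_ae p (X ^ j)] with z h1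
  rw [h1]
  simp only [Polynomial.eval_pow, Polynomial.eval_X]
  rw [integral_cis_mul_im_pow]
  refine Finset.sum_eq_zero fun m hm => ?_
  have hm' : m ≤ j := Nat.lt_succ_iff.1 (Finset.mem_range.1 hm)
  rw [if_neg, mul_zero]
  have := hp (j - m) (by omega)
  omega

end

/-! ### X-ray transform of monomials -/

/-- A product of `n` linear forms `v + ex` in two variables is a form of degree `n`. -/
lemma exists_form_mul {n : ℕ} {F : ℂ → ℂ → ℂ} (e : ℂ)
    (hF : ∃ c : ℕ → ℂ, ∀ v x, F v x = ∑ m ∈ Finset.range (n + 1), c m * v ^ m * x ^ (n - m)) :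
    ∃ c : ℕ → ℂ, ∀ v x, F v x * (v + e * x) =
      ∑ m ∈ Finset.range (n + 1 + 1), c m * v ^ m * x ^ (n + 1 - m) := by
  obtain ⟨c, hc⟩ := hF
  refine ⟨fun m => (if m = 0 then 0 else c (m - 1)) + e * (if m ≤ n then c m else 0), fun v x => ?_⟩
  simp only [add_mul, Finset.sum_add_distrib]
  rw [mul_add, hc]
  congr 1
  · rw [Finset.sum_range_succ' _ (n + 1), Finset.sum_mul]
    simp only [if_pos, zero_mul, add_zero]
    refine Finset.sum_congr rfl fun m _ => ?_
    rw [if_neg (Nat.succ_ne_zero m), Nat.add_sub_cancel, Nat.add_sub_add_right]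
    ring
  · rw [Finset.sum_range_succ _ (n + 1), Finset.sum_mul, if_neg (by omega)]
    simp only [mul_zero, zero_mul, add_zero]
    refine Finset.sum_congr rfl fun m hm => ?_
    have hm' : m ≤ n := Nat.lt_succ_iff.1 (Finset.mem_range.1 hm)
    rw [if_pos hm', Nat.succ_sub hm', pow_succ]
    ring

lemma exists_form (a b : ℕ) (e e' : ℂ) : ∃ c : ℕ → ℂ, ∀ v x : ℂ,
    (v + e * x) ^ a * (v + e' * x) ^ b =
      ∑ m ∈ Finset.range (a + b + 1), c m * v ^ m * x ^ (a + b - m) := by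
  induction b with
  | zero =>
    induction a with
    | zero => exact ⟨fun _ => 1, fun v x => by simp⟩
    | succ a ih =>
      obtain ⟨c, hc⟩ := exists_form_mul e ih
      refine ⟨c, fun v x => ?_⟩
      rw [Nat.add_right_comm, ← hc]; ring
  | succ b ih =>
    obtain ⟨c, hc⟩ := exists_form_mul e' ih
    refine ⟨c, fun v x => ?_⟩
    rw [← Nat.add_assoc, ← hc]; ring

lemma integral_odd_pow_chordMeasure {m : ℕ} (hm : Odd m) :
    ∫ u, (u : ℂ) ^ m ∂(chordMeasure γ) = 0 := by
  rw [integral_chordMeasure]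
  have h := intervalIntegral.integral_comp_neg (a := -1) (b := 1)
    (fun u : ℝ => (((1 - u ^ 2) ^ γ : ℝ) : ℂ) * (u : ℂ) ^ m)
  simp only [neg_neg, even_two.neg_pow, Complex.ofReal_neg, hm.neg_pow, mul_neg,
    intervalIntegral.integral_neg] at h
  exact self_eq_neg.1 h.symm

section

variable [hγ : Fact (-1 < γ)]

lemma integrable_chordMeasure_of_continuous {h : ℝ → ℂ} (hh : Continuous h) :
    Integrable h (chordMeasure γ) := by
  obtain ⟨C, hC⟩ := (isCompact_Icc (a := (-1 : ℝ)) (b := 1)).exists_bound_of_continuousOn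
    hh.continuousOn
  refine (integrable_const C).mono' hh.measurable.aestronglyMeasurable ?_
  have : ∀ᵐ u ∂(chordMeasure γ), u ∈ Icc (-1 : ℝ) 1 :=
    (withDensity_absolutelyContinuous _ _).ae_le (ae_restrict_mem measurableSet_Icc)
  filter_upwards [this] with u hu using hC u hu

lemma integral_form (n : ℕ) (c : ℕ → ℂ) (y x : ℂ) :
    ∫ u : ℝ, (∑ m ∈ Finset.range (n + 1), c m * (y * u) ^ m * x ^ (n - m)) ∂(chordMeasure γ) =
      ∑ m ∈ Finset.range (n + 1), c m * (∫ u, (u : ℂ) ^ m ∂(chordMeasure γ)) *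
        (y ^ m * x ^ (n - m)) := by
  have h : ∀ (u : ℝ) (m : ℕ), c m * (y * u) ^ m * x ^ (n - m) =
      (c m * (y ^ m * x ^ (n - m))) * (u : ℂ) ^ m := by intro u m; rw [mul_pow]; ring
  simp only [h]
  rw [integral_finsetSum _ fun m _ =>
    (integrable_chordMeasure_of_continuous (by fun_prop)).const_mul _]
  refine Finset.sum_congr rfl fun m _ => ?_
  rw [integral_const_mul]; ring

/-- The integral of a form of degree `n` in `(u cos α, sin α)` is a polynomial of degree at most `n`
in `sin α`, because only even powers of `cos α` survive. Replacing `cos α` by `i` and `sin α` by `1`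
gives its top coefficient. -/
lemma exists_polynomial_integral_form (n : ℕ) (c : ℕ → ℂ) :
    ∃ R : Polynomial ℂ, R.natDegree ≤ n ∧
      R.coeff n = ∫ u : ℝ, (∑ m ∈ Finset.range (n + 1), c m * (Complex.I * u) ^ m * 1 ^ (n - m))
        ∂(chordMeasure γ) ∧
      ∀ α : ℝ, R.eval ((Real.sin α : ℝ) : ℂ) =
        ∫ u : ℝ, (∑ m ∈ Finset.range (n + 1), c m * ((Real.cos α : ℝ) * u) ^ m *
          ((Real.sin α : ℝ) : ℂ) ^ (n - m)) ∂(chordMeasure γ) := by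
  have hdeg : ∀ m ∈ Finset.range (n + 1),
      ((1 - X ^ 2 : Polynomial ℂ) ^ (m / 2) * X ^ (n - m)).natDegree ≤ n := by
    intro m hm
    have hm' : m ≤ n := Nat.lt_succ_iff.1 (Finset.mem_range.1 hm)
    have h1 : (1 - X ^ 2 : Polynomial ℂ).natDegree ≤ 2 := by compute_degree
    have h2 := Polynomial.natDegree_mul_le (p := (1 - X ^ 2 : Polynomial ℂ) ^ (m / 2))
      (q := X ^ (n - m))
    have h3 := Polynomial.natDegree_pow_le_of_le (m / 2) h1
    rw [Polynomial.natDegree_X_pow] at h2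
    omega
  refine ⟨∑ m ∈ Finset.range (n + 1), C (c m * ∫ u, (u : ℂ) ^ m ∂(chordMeasure γ)) *
    ((1 - X ^ 2) ^ (m / 2) * X ^ (n - m)), ?_, ?_, fun α => ?_⟩
  · refine Polynomial.natDegree_sum_le_of_forall_le _ _ fun m hm => ?_
    exact (Polynomial.natDegree_C_mul_le _ _).trans (hdeg m hm)
  · rw [integral_form, Polynomial.finsetSum_coeff]
    refine Finset.sum_congr rfl fun m hm => ?_
    have hm' : m ≤ n := Nat.lt_succ_iff.1 (Finset.mem_range.1 hm)
    rw [Polynomial.coeff_C_mul]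
    rcases Nat.even_or_odd m with he | ho
    · obtain ⟨l, rfl⟩ := he
      have e1 : (l + l) / 2 = l := by omega
      have h1 : (1 - X ^ 2 : Polynomial ℂ).natDegree ≤ 2 := by compute_degree
      have e2 : n = l * 2 + (n - (l + l)) := by omega
      have e3 : (1 - X ^ 2 : Polynomial ℂ).coeff 2 = -1 := by
        simp [Polynomial.coeff_one]
      rw [e1]
      conv_lhs => enter [2, 2]; rw [e2]
      rw [Polynomial.coeff_mul_X_pow, Polynomial.coeff_pow_of_natDegree_le h1, e3, ← two_mul,
        pow_mul, Complex.I_sq, one_pow, mul_one]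
    · rw [integral_odd_pow_chordMeasure ho]; simp
  · rw [integral_form, Polynomial.eval_finsetSum]
    refine Finset.sum_congr rfl fun m hm => ?_
    rw [Polynomial.eval_mul, Polynomial.eval_C, Polynomial.eval_mul, Polynomial.eval_pow,
      Polynomial.eval_pow, Polynomial.eval_sub, Polynomial.eval_one, Polynomial.eval_pow,
      Polynomial.eval_X]
    rcases Nat.even_or_odd m with he | ho
    · obtain ⟨l, rfl⟩ := he
      have e1 : (l + l) / 2 = l := by omega
      have e2 : 1 - ((Real.sin α : ℝ) : ℂ) ^ 2 = ((Real.cos α : ℝ) : ℂ) ^ 2 := by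
        have := Real.cos_sq' α
        exact_mod_cast this.symm
      rw [e1, e2, ← pow_mul, two_mul]
    · rw [integral_odd_pow_chordMeasure ho]; simp

lemma integral_one_add_mul_one_sub (a b : ℕ) :
    ∫ u : ℝ, (1 + (u : ℂ)) ^ a * (1 - (u : ℂ)) ^ b ∂(chordMeasure γ) =
      ((2 ^ (a + b + 2 * γ + 1) * ProbabilityTheory.beta (a + γ + 1) (b + γ + 1) : ℝ) : ℂ) := by
  have hγ' := hγ.out
  have h := integral_jacobiWeight (s := a + γ + 1) (t := b + γ + 1)
    (by linarith [a.cast_nonneg (α := ℝ)]) (by linarith [b.cast_nonneg (α := ℝ)])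
  have e : (a : ℝ) + γ + 1 + (b + γ + 1) - 1 = a + b + 2 * γ + 1 := by ring
  rw [e] at h
  rw [← h, ← intervalIntegral.integral_ofReal, integral_chordMeasure,
    intervalIntegral.integral_of_le (by norm_num), intervalIntegral.integral_of_le (by norm_num),
    integral_Ioc_eq_integral_Ioo, integral_Ioc_eq_integral_Ioo]
  refine setIntegral_congr_fun measurableSet_Ioo fun u hu => ?_
  have h1 : 0 < 1 + u := by linarith [hu.1]
  have h2 : 0 < 1 - u := by linarith [hu.2]
  have e1 : 1 - u ^ 2 = (1 + u) * (1 - u) := by ring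
  simp only [add_sub_cancel_right]
  rw [e1, Real.mul_rpow h1.le h2.le, add_comm (a : ℝ), add_comm (b : ℝ),
    Real.rpow_add_natCast h1.ne', Real.rpow_add_natCast h2.ne']
  push_cast; ring

lemma exists_weightedXray_diskVec (a b : ℕ) : ∃ R : Polynomial ℂ, R.natDegree ≤ a + b ∧
    R.coeff (a + b) = (-1) ^ a * Complex.I ^ (a + b) *
      ((2 ^ (a + b + 2 * γ + 1) * ProbabilityTheory.beta (a + γ + 1) (b + γ + 1) : ℝ) : ℂ) ∧
    weightedXray γ (diskVec γ a b) = lineVec γ ((a : ℤ) - b) R := by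
  obtain ⟨c, hc⟩ := exists_form a b Complex.I (-Complex.I)
  obtain ⟨R, hR, hlead, heval⟩ := exists_polynomial_integral_form (γ := γ) (a + b) c
  simp only [← hc] at hlead heval
  refine ⟨C ((-1) ^ (a + b)) * R, (Polynomial.natDegree_C_mul_le _ _).trans hR, ?_, ?_⟩
  · have h : ∀ u : ℝ, (Complex.I * u + Complex.I * 1) ^ a * (Complex.I * u + -Complex.I * 1) ^ b =
        (Complex.I ^ (a + b) * (-1) ^ b) * ((1 + (u : ℂ)) ^ a * (1 - (u : ℂ)) ^ b) := by
      intro u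
      have e1 : Complex.I * u + Complex.I * 1 = Complex.I * (1 + u) := by ring
      have e2 : Complex.I * u + -Complex.I * 1 = Complex.I * (-1 * (1 - u)) := by ring
      rw [e1, e2, mul_pow, mul_pow, mul_pow, pow_add]; ring
    rw [Polynomial.coeff_C_mul, hlead]
    simp only [h]
    rw [integral_const_mul, integral_one_add_mul_one_sub]
    have e3 : (-1 : ℂ) ^ (a + b) * (-1) ^ b = (-1) ^ a := by
      rw [pow_add, mul_assoc, ← pow_add, ← two_mul, pow_mul]; norm_num
    rw [← e3]; ring
  · rw [diskVec, weightedXray_toLp, lineVec_apply]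
    refine MemLp.toLp_congr _ _ (Filter.Eventually.of_forall fun p => ?_)
    simp only
    congr 1
    have hcis : cis (p.1 + ((π + p.2 : ℝ) : S1)) = -cis (p.1 + (p.2 : S1)) := by
      rw [AddCircle.coe_add, add_left_comm, cis_add, cis_coe_pi]; ring
    have h : ∀ u : ℝ, (linePoint (p, u)).1 ^ a * conj (linePoint (p, u)).1 ^ b =
        ((-1) ^ (a + b) * cis (p.1 + (p.2 : S1)) ^ ((a : ℤ) - b)) *
        (((Real.cos p.2 : ℝ) * u + Complex.I * (Real.sin p.2 : ℝ)) ^ a *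
          ((Real.cos p.2 : ℝ) * u + -Complex.I * (Real.sin p.2 : ℝ)) ^ b) := by
      intro u
      simp only [linePoint, chordPoint, hcis, Complex.mk_eq_add_mul_I, map_mul, map_neg, map_add,
        conj_cis, Complex.conj_I, Complex.conj_ofReal, Complex.ofReal_mul]
      rw [zpow_sub₀ (cis_ne_zero _), zpow_natCast, zpow_natCast, mul_pow, mul_pow, neg_pow,
        neg_pow (cis (p.1 + (p.2 : S1)))⁻¹, inv_pow, pow_add]
      ring
    simp only [chordIntegral, h, lineFun, Polynomial.eval_mul, Polynomial.eval_C]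
    rw [integral_const_mul, heval]
    ring

/-- The eigenvalue of `I₀ d^γ (I₀ d^γ)*` on the `j`-th orthogonal polynomial in the Fourier mode
`p`: it is `σ²_{j,k}` if `p = j - 2k` with `0 ≤ k ≤ j`, and zero otherwise. -/
def modeEigenvalue (γ : ℝ) (p : ℤ) (j : ℕ) : ℝ :=
  if ∃ k ≤ j, p = (j : ℤ) - 2 * k then sigmaSq γ j (((j : ℤ) - p) / 2).toNat else 0

omit hγ in
lemma modeEigenvalue_sub (j : ℕ) {k : ℕ} (hk : k ≤ j) :
    modeEigenvalue γ ((j : ℤ) - 2 * k) j = sigmaSq γ j k := by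
  rw [modeEigenvalue, if_pos ⟨k, hk, rfl⟩]
  congr 1; omega

omit hγ in
lemma modeEigenvalue_eq_zero {p : ℤ} {j : ℕ} (h : ∀ k ≤ j, p ≠ (j : ℤ) - 2 * k) :
    modeEigenvalue γ p j = 0 := by
  rw [modeEigenvalue, if_neg]
  rintro ⟨k, hk, e⟩
  exact h k hk e

omit hγ in
lemma sigmaSq_eq_beta {j k : ℕ} (hk : k ≤ j) : sigmaSq γ j k =
    2 ^ (2 * γ + 2) * π * (j.choose k : ℝ) *
      ProbabilityTheory.beta (((j - k : ℕ) : ℝ) + γ + 1) (k + γ + 1) := by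
  rw [sigmaSq, ProbabilityTheory.beta, Nat.cast_sub hk]
  congr 3; ring

/-- In each Fourier mode, `I₀ d^γ (I₀ d^γ)*` is triangular with respect to the powers of `sin α`. -/
lemma exists_weightedXray_adjoint_X_pow (p : ℤ) (j : ℕ) : ∃ R : Polynomial ℂ, R.natDegree ≤ j ∧
    R.coeff j = (modeEigenvalue γ p j : ℂ) ∧
    weightedXray γ (ContinuousLinearMap.adjoint (weightedXray γ) (lineVec γ p (X ^ j))) =
      lineVec γ p R := by
  by_cases h : ∃ k ≤ j, p = (j : ℤ) - 2 * k
  · obtain ⟨k, hk, rfl⟩ := h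
    obtain ⟨R, h1, h2, h3⟩ := exists_weightedXray_diskVec (γ := γ) (j - k) k
    have ejk : j - k + k = j := Nat.sub_add_cancel hk
    rw [ejk] at h1 h2
    refine ⟨C (2 * π * (-1) ^ j * (-1) ^ k * (2 * Complex.I)⁻¹ ^ j * (j.choose k : ℂ)) * R,
      (Polynomial.natDegree_C_mul_le _ _).trans h1, ?_, ?_⟩
    · have hpow : (2 : ℝ) ^ (((j - k : ℕ) : ℝ) + k + 2 * γ + 1) * 2 * (2⁻¹) ^ j =
          2 ^ (2 * γ + 2) := by
        have e : ((j - k : ℕ) : ℝ) + k + 2 * γ + 1 = (2 * γ + 1) + (j : ℕ) := by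
          rw [Nat.cast_sub hk]; ring
        rw [e, Real.rpow_add_natCast (by norm_num), inv_pow,
          show 2 * γ + 2 = (2 * γ + 1) + 1 by ring, Real.rpow_add_one (by norm_num) (2 * γ + 1)]
        field_simp
      have hI : (2 * Complex.I)⁻¹ ^ j * Complex.I ^ j = ((2⁻¹ : ℝ) : ℂ) ^ j := by
        rw [← mul_pow]; congr 1; push_cast; field_simp
      have hsign : (-1 : ℂ) ^ j * (-1) ^ k * (-1) ^ (j - k) = 1 := by
        rw [mul_assoc, ← pow_add, Nat.add_sub_cancel' hk, ← pow_add, ← two_mul, pow_mul]; norm_num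
      rw [Polynomial.coeff_C_mul, h2, modeEigenvalue_sub j hk, sigmaSq_eq_beta hk, ← hpow]
      calc _ = ((-1 : ℂ) ^ j * (-1) ^ k * (-1) ^ (j - k)) *
            ((2 * Complex.I)⁻¹ ^ j * Complex.I ^ j) * (2 * π * (j.choose k : ℂ) *
            ((2 ^ (((j - k : ℕ) : ℝ) + k + 2 * γ + 1) * ProbabilityTheory.beta
              (((j - k : ℕ) : ℝ) + γ + 1) (k + γ + 1) : ℝ) : ℂ)) := by ring
        _ = _ := by
          rw [hsign, hI]; push_cast; ring
    · rw [adjoint_lineVec_X_pow hk, map_smul, h3, ← Polynomial.smul_eq_C_mul, map_smul,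
        show ((j - k : ℕ) : ℤ) - k = j - 2 * k by push_cast [hk]; ring]
  · push Not at h
    refine ⟨0, by simp, by simp [modeEigenvalue_eq_zero h], ?_⟩
    rw [adjoint_lineVec_X_pow_eq_zero h, map_zero, map_zero]

end

/-! ### Reversal of the direction of lines -/

lemma measurePreserving_antipodal (γ : ℝ) :
    MeasurePreserving antipodal (fanMeasure γ) (fanMeasure γ) := by
  have h1 : MeasurePreserving (fun a : ℝ => -a) (volume.restrict (Icc (-(π / 2)) (π / 2)))
      (volume.restrict (Icc (-(π / 2)) (π / 2))) := by
    have := (Measure.measurePreserving_neg (volume : Measure ℝ)).restrict_preimage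
      (s := Icc (-(π / 2)) (π / 2)) measurableSet_Icc
    convert this using 2
    ext a; simp only [mem_preimage, mem_Icc]; constructor <;> rintro ⟨h1, h2⟩ <;> constructor <;>
      linarith
  have h2 := MeasurePreserving.skew_product (μc := (volume : Measure S1)) (μd := volume) h1
    (g := fun a β => β + ((π + 2 * a : ℝ) : S1)) (by unfold Function.uncurry; fun_prop)
    (Filter.Eventually.of_forall fun a =>
      (measurePreserving_add_right (volume : Measure S1) _).map_eq)
  have h3 : MeasurePreserving antipodal flatMeasure flatMeasure :=
    (Measure.measurePreserving_swap.comp h2).comp Measure.measurePreserving_swap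
  rw [fanMeasure_eq]
  exact measurePreserving_withDensity h3 (measurable_muBdf_rpow _).ennreal_ofReal fun p => by
    simp [antipodal, muBdf]

lemma antipodal_antipodal (p : S1 × ℝ) : antipodal (antipodal p) = p := by
  obtain ⟨b, a⟩ := p
  simp only [antipodal, neg_neg, Prod.mk.injEq, and_true]
  have h : ((π + 2 * a : ℝ) : S1) + ((π + 2 * -a : ℝ) : S1) = 0 := by
    rw [← AddCircle.coe_add, show π + 2 * a + (π + 2 * -a) = 2 * π by ring, AddCircle.coe_period]
  rw [add_assoc, h, add_zero]

/-- The isometry `g ↦ g ∘ S_A`. -/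
def reversal (γ : ℝ) : L2Fan γ →ₗᵢ[ℂ] L2Fan γ :=
  Lp.compMeasurePreservingₗᵢ ℂ antipodal (measurePreserving_antipodal γ)

lemma reversal_ae (g : L2Fan γ) : reversal γ g =ᵐ[fanMeasure γ] fun p => g (antipodal p) :=
  Lp.coeFn_compMeasurePreserving g (measurePreserving_antipodal γ)

lemma isEven_iff (g : L2Fan γ) : IsEven γ g ↔ reversal γ g = g := by
  rw [Lp.ext_iff]
  exact Filter.eventually_congr ((reversal_ae g).mono fun p hp => by rw [hp])

lemma isOdd_iff (g : L2Fan γ) : IsOdd γ g ↔ reversal γ g = -g := by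
  rw [Lp.ext_iff]
  refine Filter.eventually_congr ?_
  filter_upwards [reversal_ae g, Lp.coeFn_neg g] with p hp h2
  rw [hp, h2, Pi.neg_apply]

lemma reversal_reversal (g : L2Fan γ) : reversal γ (reversal γ g) = g := by
  rw [Lp.ext_iff]
  filter_upwards [reversal_ae (reversal γ g),
    (measurePreserving_antipodal γ).quasiMeasurePreserving.ae (reversal_ae g)] with p h1 h2
  rw [h1, h2, antipodal_antipodal]

lemma inner_reversal_left (g h : L2Fan γ) : ⟪reversal γ g, h⟫_ℂ = ⟪g, reversal γ h⟫_ℂ := by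
  conv_lhs => rw [← reversal_reversal h]
  exact (reversal γ).inner_map_map _ _

section

variable [hγ : Fact (-1 < γ)]

lemma reversal_lineVec_X_pow (p : ℤ) (j : ℕ) :
    reversal γ (lineVec γ p (X ^ j)) = ((-1) ^ p * (-1) ^ j : ℂ) • lineVec γ p (X ^ j) := by
  rw [Lp.ext_iff]
  have h0 := (memLp_muBdf_mul (memLp_lineFun (γ := γ) p (X ^ j))).coeFn_toLp
  filter_upwards [reversal_ae (lineVec γ p (X ^ j)), Lp.coeFn_smul ((-1) ^ p * (-1) ^ j : ℂ)
    (lineVec γ p (X ^ j)), h0, (measurePreserving_antipodal γ).quasiMeasurePreserving.ae h0]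
    with q h1 h2 h3 h4
  rw [h1, h2, Pi.smul_apply, lineVec_apply, h3, h4]
  have e : (antipodal q).1 + ((antipodal q).2 : S1) = (q.1 + (q.2 : S1)) + ((π : ℝ) : S1) := by
    simp only [antipodal]
    rw [add_assoc, add_assoc, ← AddCircle.coe_add, ← AddCircle.coe_add]
    congr 2; ring
  rw [lineFun_X_pow, lineFun_X_pow, e, cis_add, cis_coe_pi, mul_zpow]
  simp only [muBdf, antipodal, Real.cos_neg, Real.sin_neg, smul_eq_mul, Complex.ofReal_neg]
  rw [neg_pow]
  ring

/-- The values of `I₀ d^γ` are even: the complete system of the monomials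
`μ^{2γ+1} e^{ip(β+α)} sin^j α` consists of even functions and of functions in the kernel of the
adjoint. -/
lemma reversal_weightedXray (f : L2Disk γ) :
    reversal γ (weightedXray γ f) = weightedXray γ f := by
  rw [← sub_eq_zero]
  refine eq_zero_of_forall_inner_lineVec _ fun p j => ?_
  rw [inner_sub_right, ← inner_reversal_left, reversal_lineVec_X_pow, sub_eq_zero]
  by_cases h : ∃ k ≤ j, p = (j : ℤ) - 2 * k
  · obtain ⟨k, hk, rfl⟩ := h
    have : ((-1) ^ ((j : ℤ) - 2 * k) * (-1) ^ j : ℂ) = 1 := by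
      rw [zpow_sub₀ (by norm_num), zpow_mul, zpow_natCast]
      norm_num [← mul_pow]
    rw [this, one_smul]
  · push Not at h
    rw [inner_smul_left, ← ContinuousLinearMap.adjoint_inner_left,
      adjoint_lineVec_X_pow_eq_zero h, inner_zero_left, mul_zero]

/-! ### Symmetric triangular operators are diagonalized by orthogonal polynomials -/

variable {p : ℤ} {P : ℕ → Polynomial ℂ}

omit hγ in
/-- Polynomials of degree less than `n` are combinations of `P 0, …, P (n - 1)`. -/
lemma mem_span_of_degree_lt (hP : ∀ n, (P n).degree = n) (n : ℕ) {Q : Polynomial ℂ}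
    (hQ : Q.degree < n) : Q ∈ Submodule.span ℂ (P '' Iio n) := by
  induction n generalizing Q with
  | zero =>
    have : Q = 0 := by
      rw [Polynomial.degree_lt_iff_coeff_zero] at hQ
      ext m; simpa using hQ m (Nat.zero_le m)
    rw [this]; exact Submodule.zero_mem _
  | succ n ih =>
    have hlead : (P n).coeff n ≠ 0 := Polynomial.coeff_ne_zero_of_eq_degree (hP n)
    have h1 : (Q - C (Q.coeff n / (P n).coeff n) * P n).degree < n := by
      rw [Polynomial.degree_lt_iff_coeff_zero] at hQ ⊢
      intro m hm
      rw [Polynomial.coeff_sub, Polynomial.coeff_C_mul]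
      rcases hm.eq_or_lt with rfl | hm
      · field_simp; ring
      · rw [hQ m hm, Polynomial.coeff_eq_zero_of_degree_lt (p := P n) (n := m)
          (by rw [hP]; exact_mod_cast hm)]
        ring
    have h2 := Submodule.span_mono (R := ℂ) (image_mono (f := P) (Iio_subset_Iio n.le_succ)) (ih h1)
    have h3 : P n ∈ Submodule.span ℂ (P '' Iio (n + 1)) :=
      Submodule.subset_span ⟨n, Nat.lt_succ_self n, rfl⟩
    have h4 := Submodule.add_mem _ h2 (Submodule.smul_mem _ (Q.coeff n / (P n).coeff n) h3)
    rwa [Polynomial.smul_eq_C_mul, sub_add_cancel] at h4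

lemma inner_lineVec_eq_zero_of_degree_lt (hP : ∀ n, (P n).degree = n)
    (horth : ∀ m n, m ≠ n → ⟪lineVec γ p (P m), lineVec γ p (P n)⟫_ℂ = 0) {n : ℕ}
    {Q : Polynomial ℂ} (hQ : Q.degree < n) : ⟪lineVec γ p Q, lineVec γ p (P n)⟫_ℂ = 0 := by
  have h := mem_span_of_degree_lt hP n hQ
  clear hQ
  induction h using Submodule.span_induction with
  | mem x hx =>
    obtain ⟨m, hm, rfl⟩ := hx
    exact horth m n (ne_of_lt hm)
  | zero => simp
  | add a b _ _ ha hb => rw [map_add, inner_add_left, ha, hb, add_zero]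
  | smul c a _ ha => rw [map_smul, inner_smul_left, ha, mul_zero]

lemma exists_triangular {T : L2Fan γ →ₗ[ℂ] L2Fan γ} {e : ℕ → ℂ}
    (hT : ∀ j, ∃ R : Polynomial ℂ, R.natDegree ≤ j ∧ R.coeff j = e j ∧
      T (lineVec γ p (X ^ j)) = lineVec γ p R) (n : ℕ) {Q : Polynomial ℂ}
    (hQ : Q.degree < (n + 1 : ℕ)) :
    ∃ R : Polynomial ℂ, R.degree < (n + 1 : ℕ) ∧ R.coeff n = e n * Q.coeff n ∧
      T (lineVec γ p Q) = lineVec γ p R := by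
  choose R hR hlead heq using hT
  have hQ' : Q = ∑ j ∈ Finset.range (n + 1), Q.coeff j • X ^ j := by
    conv_lhs => rw [Polynomial.as_sum_range_C_mul_X_pow' Q (n := n + 1) (by
      rcases eq_or_ne Q 0 with rfl | h
      · simp
      · exact (Polynomial.natDegree_lt_iff_degree_lt h).2 hQ)]
    simp only [Polynomial.smul_eq_C_mul]
  have hcoeff : ∀ j m, j < m → (R j).coeff m = 0 := fun j m h =>
    Polynomial.coeff_eq_zero_of_natDegree_lt ((hR j).trans_lt h)
  refine ⟨∑ j ∈ Finset.range (n + 1), Q.coeff j • R j, ?_, ?_, ?_⟩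
  · rw [Polynomial.degree_lt_iff_coeff_zero]
    intro m hm
    rw [Polynomial.finsetSum_coeff]
    refine Finset.sum_eq_zero fun j hj => ?_
    rw [Polynomial.coeff_smul, hcoeff j m ((Finset.mem_range.1 hj).trans_le hm), smul_zero]
  · rw [Polynomial.finsetSum_coeff, Finset.sum_range_succ, Finset.sum_eq_zero fun j hj => ?_]
    · rw [Polynomial.coeff_smul, hlead, smul_eq_mul, zero_add, mul_comm]
    · rw [Polynomial.coeff_smul, hcoeff j n (Finset.mem_range.1 hj), smul_zero]
  · conv_lhs => rw [hQ']
    simp only [map_sum, map_smul, heq]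

lemma exists_triangular_of_degree_lt {T : L2Fan γ →ₗ[ℂ] L2Fan γ} {e : ℕ → ℂ}
    (hT : ∀ j, ∃ R : Polynomial ℂ, R.natDegree ≤ j ∧ R.coeff j = e j ∧
      T (lineVec γ p (X ^ j)) = lineVec γ p R) (n : ℕ) {Q : Polynomial ℂ}
    (hQ : Q.degree < n) : ∃ R : Polynomial ℂ, R.degree < n ∧
      T (lineVec γ p Q) = lineVec γ p R := by
  rcases n with _ | n
  · have : Q = 0 := by
      rw [Polynomial.degree_lt_iff_coeff_zero] at hQ
      ext m; simpa using hQ m (Nat.zero_le m)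
    exact ⟨0, by rw [← this]; exact hQ, by simp [this]⟩
  · obtain ⟨R, h1, -, h3⟩ := exists_triangular hT n hQ
    exact ⟨R, h1, h3⟩

/-- A symmetric operator that is triangular with respect to the powers of `sin α`, with diagonal
entries `e n`, is diagonalized by the orthogonal polynomials: `T - e n` maps the `n`-th one to a
polynomial of lower degree, to which the image is also orthogonal by symmetry. -/
lemma apply_lineVec_of_triangular {T : L2Fan γ →ₗ[ℂ] L2Fan γ} {e : ℕ → ℂ}
    (hsymm : ∀ g h, ⟪T g, h⟫_ℂ = ⟪g, T h⟫_ℂ)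
    (hT : ∀ j, ∃ R : Polynomial ℂ, R.natDegree ≤ j ∧ R.coeff j = e j ∧
      T (lineVec γ p (X ^ j)) = lineVec γ p R)
    (hP : ∀ n, (P n).degree = n)
    (horth : ∀ m n, m ≠ n → ⟪lineVec γ p (P m), lineVec γ p (P n)⟫_ℂ = 0) (n : ℕ) :
    T (lineVec γ p (P n)) = e n • lineVec γ p (P n) := by
  obtain ⟨R, h1, h2, h3⟩ := exists_triangular hT n (Q := P n) (by
    rw [hP]; exact_mod_cast n.lt_succ_self)
  have hS : (R - e n • P n).degree < n := by
    rw [Polynomial.degree_lt_iff_coeff_zero] at h1 ⊢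
    intro m hm
    rw [Polynomial.coeff_sub, Polynomial.coeff_smul, smul_eq_mul]
    rcases hm.eq_or_lt with rfl | hm
    · rw [h2, sub_self]
    · rw [h1 m hm, Polynomial.coeff_eq_zero_of_degree_lt (p := P n) (n := m)
        (by rw [hP]; exact_mod_cast hm)]
      ring
  have hv : T (lineVec γ p (P n)) - e n • lineVec γ p (P n) = lineVec γ p (R - e n • P n) := by
    rw [h3, map_sub, map_smul]
  obtain ⟨R', h4, h5⟩ := exists_triangular_of_degree_lt hT n hS
  rw [← sub_eq_zero, ← inner_self_eq_zero (𝕜 := ℂ)]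
  nth_rewrite 1 [hv]
  rw [inner_sub_right, ← hsymm, h5, inner_lineVec_eq_zero_of_degree_lt hP horth h4,
    inner_smul_right, inner_lineVec_eq_zero_of_degree_lt hP horth hS, mul_zero, sub_zero]

lemma reversal_lineVec (hP : ∀ n, (P n).degree = n)
    (horth : ∀ m n, m ≠ n → ⟪lineVec γ p (P m), lineVec γ p (P n)⟫_ℂ = 0) (n : ℕ) :
    reversal γ (lineVec γ p (P n)) = ((-1) ^ p * (-1) ^ n : ℂ) • lineVec γ p (P n) :=
  apply_lineVec_of_triangular (T := (reversal γ).toLinearMap) (e := fun n => (-1) ^ p * (-1) ^ n)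
    inner_reversal_left (fun j => ⟨((-1) ^ p * (-1) ^ j : ℂ) • X ^ j,
      (Polynomial.natDegree_smul_le _ _).trans (Polynomial.natDegree_X_pow_le j), by simp,
      by rw [map_smul]; exact reversal_lineVec_X_pow p j⟩) hP horth n

lemma weightedXray_adjoint_lineVec (hP : ∀ n, (P n).degree = n)
    (horth : ∀ m n, m ≠ n → ⟪lineVec γ p (P m), lineVec γ p (P n)⟫_ℂ = 0) (n : ℕ) :
    weightedXray γ (ContinuousLinearMap.adjoint (weightedXray γ) (lineVec γ p (P n))) =
      (modeEigenvalue γ p n : ℂ) • lineVec γ p (P n) :=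
  apply_lineVec_of_triangular
    (T := (weightedXray γ ∘L ContinuousLinearMap.adjoint (weightedXray γ)).toLinearMap)
    (e := fun n => (modeEigenvalue γ p n : ℂ))
    (fun g h => by
      simp only [ContinuousLinearMap.coe_coe, ContinuousLinearMap.comp_apply]
      rw [← ContinuousLinearMap.adjoint_inner_left, ← ContinuousLinearMap.adjoint_inner_right])
    (exists_weightedXray_adjoint_X_pow p) hP horth n

/-! ### Nonvanishing, and the weight of the orthogonal polynomials -/

lemma lineVec_ne_zero {Q : Polynomial ℂ} (hQ : Q ≠ 0) : lineVec γ p Q ≠ 0 := by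
  intro h
  rw [lineVec_apply, Lp.eq_zero_iff_ae_eq_zero] at h
  have h1 : ∀ᵐ q ∂flatMeasure, Q.eval ((Real.sin q.2 : ℝ) : ℂ) = 0 := by
    rw [← ae_fanMeasure (γ := γ)]
    filter_upwards [h, (memLp_muBdf_mul (memLp_lineFun p Q)).coeFn_toLp, ae_fan_mem] with q h1 h2 h3
    rw [h2, Pi.zero_apply, lineFun, mul_eq_zero, mul_eq_zero] at h1
    have e1 : ((muBdf q ^ (2 * γ + 1) : ℝ) : ℂ) ≠ 0 :=
      Complex.ofReal_ne_zero.2 (Real.rpow_pos_of_pos (muBdf_pos h3) _).ne'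
    have e2 : cis (q.1 + (q.2 : S1)) ^ p ≠ 0 := zpow_ne_zero _ (cis_ne_zero _)
    tauto
  have hfin : {a ∈ Icc (-(π / 2)) (π / 2) | Q.eval ((Real.sin a : ℝ) : ℂ) = 0}.Finite := by
    have h3 : InjOn (fun a : ℝ => ((Real.sin a : ℝ) : ℂ)) (Icc (-(π / 2)) (π / 2)) :=
      fun x hx y hy hxy => Real.injOn_sin hx hy (Complex.ofReal_injective hxy)
    refine Finite.of_finite_image ((Polynomial.finite_setOfPred_isRoot hQ).subset ?_)
      (h3.mono (sep_subset _ _))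
    rintro _ ⟨a, ⟨-, ha⟩, rfl⟩
    exact ha
  have h2 : ∃ b : S1, ∀ᵐ a ∂(volume.restrict (Icc (-(π / 2)) (π / 2))),
      Q.eval ((Real.sin a : ℝ) : ℂ) = 0 := (Measure.ae_ae_of_ae_prod h1).exists
  obtain ⟨-, h2⟩ := h2
  have h4 : ∀ᵐ a ∂(volume : Measure ℝ), ¬ (a ∈ Icc (-(π / 2)) (π / 2) ∧
      Q.eval ((Real.sin a : ℝ) : ℂ) = 0) :=
    measure_eq_zero_iff_ae_notMem.1 (hfin.measure_zero volume)
  have h5 : ∀ᵐ a ∂(volume.restrict (Icc (-(π / 2)) (π / 2))), False := by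
    filter_upwards [h2, ae_restrict_of_ae h4, ae_restrict_mem measurableSet_Icc] with a h6 h7 h8
    exact h7 ⟨h8, h6⟩
  rw [Filter.eventually_false_iff_eq_bot, ae_eq_bot, Measure.restrict_eq_zero, Real.volume_Icc,
    ENNReal.ofReal_eq_zero] at h5
  linarith [Real.pi_pos]

omit hγ in
lemma integral_angleMeasure (hγ : -1 < γ) (F : ℝ → ℝ) : ∫ α, F (Real.sin α) ∂(angleMeasure γ) =
    ∫ x in (-1 : ℝ)..1, F x * (1 - x ^ 2) ^ (γ + 1 / 2) := by
  have e2 := integral_image_eq_integral_abs_deriv_smul (s := Icc (-(π / 2)) (π / 2))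
    measurableSet_Icc (fun x _ => (Real.hasDerivAt_sin x).hasDerivWithinAt) Real.injOn_sin
    (fun x => F x * (1 - x ^ 2) ^ (γ + 1 / 2))
  rw [Real.bijOn_sin.image_eq] at e2
  rw [intervalIntegral.integral_of_le (by norm_num), ← integral_Icc_eq_integral_Ioc, e2,
    angleMeasure, integral_withDensity_eq_integral_toReal_smul (measurable_angleDensity γ)
      (by simp)]
  refine setIntegral_congr_fun measurableSet_Icc fun α hα => ?_
  have hc : 0 ≤ Real.cos α := Real.cos_nonneg_of_mem_Icc hα
  simp only [smul_eq_mul]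
  rw [ENNReal.toReal_ofReal (by positivity), ← Real.cos_sq', abs_of_nonneg hc, ← Real.rpow_two,
    ← Real.rpow_mul hc, mul_left_comm, mul_comm]
  congr 1
  conv_rhs => enter [1]; rw [← Real.rpow_one (Real.cos α)]
  rw [← Real.rpow_add' hc (by linarith)]
  congr 1; ring

end

/-! ### Singular value decompositions from eigenvectors of `A A*` -/

section Hilbert

variable {H K : Type*} [NormedAddCommGroup H] [InnerProductSpace ℂ H] [NormedAddCommGroup K]
  [InnerProductSpace ℂ K]

lemma inner_quotient_mk (S : Submodule ℂ K) [S.HasOrthogonalProjection] {x y : K}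
    (hx : x ∈ Sᗮ) (hy : y ∈ Sᗮ) :
    ⟪(Submodule.Quotient.mk x : K ⧸ S), Submodule.Quotient.mk y⟫_ℂ = ⟪x, y⟫_ℂ := by
  rw [← S.quotientEquivOrthogonal.inner_map_map, S.quotientEquivOrthogonal_mk x hx,
    S.quotientEquivOrthogonal_mk y hy, Submodule.coe_inner]

lemma norm_adjoint_of_eigenvector [CompleteSpace H] [CompleteSpace K] (A : H →L[ℂ] K) {v : K}
    {s : ℝ} (hs : 0 < s) (h : A (ContinuousLinearMap.adjoint A v) = (s : ℂ) • v) :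
    ‖ContinuousLinearMap.adjoint A v‖ = √s * ‖v‖ := by
  have h1 : (‖ContinuousLinearMap.adjoint A v‖ : ℂ) ^ 2 = (s : ℂ) * (‖v‖ : ℂ) ^ 2 := by
    have h2 := ContinuousLinearMap.adjoint_inner_left A (ContinuousLinearMap.adjoint A v) v
    rwa [h, inner_smul_right, inner_self_eq_norm_sq_to_K, inner_self_eq_norm_sq_to_K] at h2
  have h3 : ‖ContinuousLinearMap.adjoint A v‖ ^ 2 = (√s * ‖v‖) ^ 2 := by
    rw [mul_pow, Real.sq_sqrt hs.le]; exact_mod_cast h1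
  exact (pow_left_inj₀ (norm_nonneg _) (by positivity) two_ne_zero).1 h3

variable [NormedSpace ℝ H] [IsScalarTower ℝ ℂ H] [NormedSpace ℝ K] [IsScalarTower ℝ ℂ K]

lemma normalize_eq_smul (x : H) : NormedSpace.normalize x = ((‖x‖⁻¹ : ℝ) : ℂ) • x :=
  (algebraMap_smul ℂ (‖x‖⁻¹) x).symm

lemma span_normalize_eq {ι : Type*} {v : ι → K} (hv : ∀ i, v i ≠ 0) :
    Submodule.span ℂ (range fun i => NormedSpace.normalize (v i)) =
      Submodule.span ℂ (range v) := by
  refine le_antisymm (Submodule.span_le.2 ?_) (Submodule.span_le.2 ?_)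
  · rintro _ ⟨i, rfl⟩
    simp only [normalize_eq_smul]
    exact Submodule.smul_mem _ _ (Submodule.subset_span ⟨i, rfl⟩)
  · rintro _ ⟨i, rfl⟩
    have h : v i = (‖v i‖ : ℂ) • NormedSpace.normalize (v i) := by
      rw [normalize_eq_smul, smul_smul, ← Complex.ofReal_mul,
        mul_inv_cancel₀ (norm_ne_zero_iff.2 (hv i)), Complex.ofReal_one, one_smul]
    rw [SetLike.mem_coe, h]
    exact Submodule.smul_mem _ _ (Submodule.subset_span ⟨i, rfl⟩)

lemma orthonormal_normalize {ι : Type*} {v : ι → K} (hv : ∀ i, v i ≠ 0)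
    (h : Pairwise fun i j => ⟪v i, v j⟫_ℂ = 0) :
    Orthonormal ℂ fun i => NormedSpace.normalize (v i) := by
  refine ⟨fun i => NormedSpace.norm_normalize (hv i), fun i j hij => ?_⟩
  change ⟪NormedSpace.normalize (v i), NormedSpace.normalize (v j)⟫_ℂ = 0
  rw [normalize_eq_smul, normalize_eq_smul, inner_smul_left, inner_smul_right, h hij, mul_zero,
    mul_zero]

variable [CompleteSpace H] [CompleteSpace K]

lemma apply_normalize_of_eigenvector (A : H →L[ℂ] K) {v : K} {s : ℝ} (hs : 0 < s)
    (h : A (ContinuousLinearMap.adjoint A v) = (s : ℂ) • v) :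
    A (NormedSpace.normalize (ContinuousLinearMap.adjoint A v)) =
      (√s : ℂ) • NormedSpace.normalize v := by
  rw [normalize_eq_smul, normalize_eq_smul, norm_adjoint_of_eigenvector A hs h, map_smul, h,
    smul_smul, smul_smul]
  congr 1
  rw [← Complex.ofReal_mul, ← Complex.ofReal_mul]
  congr 1
  have h0 : √s ≠ 0 := (Real.sqrt_pos.2 hs).ne'
  rw [mul_inv, mul_right_comm]
  congr 1
  rw [inv_mul_eq_div, Real.div_sqrt]

lemma adjoint_normalize_of_eigenvector (A : H →L[ℂ] K) {v : K} {s : ℝ} (hs : 0 < s)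
    (h : A (ContinuousLinearMap.adjoint A v) = (s : ℂ) • v) :
    ContinuousLinearMap.adjoint A (NormedSpace.normalize v) =
      (√s : ℂ) • NormedSpace.normalize (ContinuousLinearMap.adjoint A v) := by
  rw [normalize_eq_smul, normalize_eq_smul, norm_adjoint_of_eigenvector A hs h, map_smul,
    smul_smul]
  congr 1
  rw [← Complex.ofReal_mul]
  congr 1
  have h0 : √s ≠ 0 := (Real.sqrt_pos.2 hs).ne'
  rw [mul_inv, mul_inv_cancel_left₀ h0]

/-- Eigenvectors `v i` of `A A*` with positive eigenvalues `s i` for which the `A* (v i)` are total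
form the right half of a singular value decomposition of `A`, viewed as an operator into the
quotient by `ker A*`. -/
lemma isSVD_of_eigenvectors {ι : Type*} (A : H →L[ℂ] K) {v : ι → K} {s : ι → ℝ}
    (hs : ∀ i, 0 < s i) (hv : ∀ i, v i ≠ 0) (hvv : Pairwise fun i j => ⟪v i, v j⟫_ℂ = 0)
    (h : ∀ i, A (ContinuousLinearMap.adjoint A (v i)) = (s i : ℂ) • v i)
    (hc : ∀ f : H, (∀ i, ⟪ContinuousLinearMap.adjoint A (v i), f⟫_ℂ = 0) → f = 0) :
    IsSVD ((LinearMap.ker (ContinuousLinearMap.adjoint A : K →ₗ[ℂ] H)).mkQL ∘L A)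
      (fun i => NormedSpace.normalize (ContinuousLinearMap.adjoint A (v i)))
      (fun i => Submodule.Quotient.mk (NormedSpace.normalize (v i)))
      (fun i => √(s i)) := by
  set S := LinearMap.ker (ContinuousLinearMap.adjoint A : K →ₗ[ℂ] H) with hS
  have hs' : ∀ i, (s i : ℂ) ≠ 0 := fun i => Complex.ofReal_ne_zero.2 (hs i).ne'
  have hGne : ∀ i, ContinuousLinearMap.adjoint A (v i) ≠ 0 := by
    intro i h0
    have h2 := h i
    rw [h0, map_zero] at h2
    exact smul_ne_zero (hs' i) (hv i) h2.symm
  have hGG : Pairwise fun i j => ⟪ContinuousLinearMap.adjoint A (v i),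
      ContinuousLinearMap.adjoint A (v j)⟫_ℂ = 0 := by
    intro i j hij
    rw [ContinuousLinearMap.adjoint_inner_left, h j, inner_smul_right, hvv hij, mul_zero]
  -- the `v i` lie in the range of `A`, which is orthogonal to the kernel of `A*`
  have hmem : ∀ i, NormedSpace.normalize (v i) ∈ Sᗮ := by
    intro i
    have h2 : v i = ((s i : ℂ))⁻¹ • A (ContinuousLinearMap.adjoint A (v i)) := by
      rw [h, smul_smul, inv_mul_cancel₀ (hs' i), one_smul]
    rw [normalize_eq_smul]
    refine Submodule.smul_mem _ _ ?_
    rw [h2]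
    refine Submodule.smul_mem _ _ ((Submodule.mem_orthogonal _ _).2 fun u hu => ?_)
    rw [← ContinuousLinearMap.adjoint_inner_left, show ContinuousLinearMap.adjoint A u = 0 from hu,
      inner_zero_left]
  have hortho := orthonormal_normalize hv hvv
  have hdense : (S ⊔ Submodule.span ℂ (range v)).topologicalClosure = ⊤ := by
    rw [Submodule.topologicalClosure_eq_top_iff, Submodule.eq_bot_iff]
    intro y hy
    rw [← Submodule.inf_orthogonal] at hy
    have hy0 : ContinuousLinearMap.adjoint A y = 0 := by
      refine hc _ fun i => ?_
      rw [ContinuousLinearMap.adjoint_inner_right, h, inner_smul_left,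
        (Submodule.mem_orthogonal _ _).1 hy.2 _ (Submodule.subset_span ⟨i, rfl⟩), mul_zero]
    exact inner_self_eq_zero.1 ((Submodule.mem_orthogonal _ _).1 hy.1 y hy0)
  refine ⟨orthonormal_normalize hGne hGG, ?_, ⟨fun i => ?_, fun i j hij => ?_⟩, ?_,
    fun i => Real.sqrt_pos.2 (hs i), fun i => ?_⟩
  · rw [span_normalize_eq hGne, Submodule.topologicalClosure_eq_top_iff, Submodule.eq_bot_iff]
    intro f hf
    exact hc f fun i => (Submodule.mem_orthogonal _ _).1 hf _ (Submodule.subset_span ⟨i, rfl⟩)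
  · have h1 := inner_quotient_mk S (hmem i) (hmem i)
    rw [inner_self_eq_norm_sq_to_K, inner_self_eq_norm_sq_to_K, hortho.1 i] at h1
    have h2 : ‖(Submodule.Quotient.mk (NormedSpace.normalize (v i)) : K ⧸ S)‖ ^ 2 = 1 ^ 2 := by
      exact_mod_cast h1
    exact (pow_left_inj₀ (norm_nonneg _) zero_le_one two_ne_zero).1 h2
  · exact (inner_quotient_mk S (hmem i) (hmem j)).trans (hortho.2 hij)
  · have h1 := Submodule.topologicalClosure_map S.mkQL (S ⊔ Submodule.span ℂ (range v))
    have h2 : LinearMap.range (S.mkQL : K →ₗ[ℂ] K ⧸ S) = ⊤ := by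
      rw [Submodule.toLinearMap_mkQL, Submodule.range_mkQ]
    rw [hdense, Submodule.map_top, h2] at h1
    refine top_le_iff.1 (h1.trans (Submodule.topologicalClosure_mono ?_))
    rw [← span_normalize_eq hv, Submodule.map_sup, sup_le_iff]
    refine ⟨?_, ?_⟩
    · rintro _ ⟨x, hx, rfl⟩
      have e : (S.mkQL : K →ₗ[ℂ] K ⧸ S) x = 0 := (Submodule.Quotient.mk_eq_zero S).2 hx
      rw [e]
      exact Submodule.zero_mem _
    · rw [Submodule.map_span, Submodule.span_le]
      rintro _ ⟨_, ⟨i, rfl⟩, rfl⟩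
      exact Submodule.subset_span ⟨i, rfl⟩
  · rw [ContinuousLinearMap.comp_apply, apply_normalize_of_eigenvector A (hs i) (h i), map_smul]
    rfl

end Hilbert

/-! ### The singular values -/

lemma sigmaSq_pos (hγ : -1 < γ) {n k : ℕ} (hk : k ≤ n) : 0 < sigmaSq γ n k := by
  have h1 : (k : ℝ) ≤ n := by exact_mod_cast hk
  have h2 : 0 < (n.choose k : ℝ) := by exact_mod_cast Nat.choose_pos hk
  have h3 : (0 : ℝ) ≤ k := k.cast_nonneg
  have h4 := Real.Gamma_pos_of_pos (s := n - k + γ + 1) (by linarith)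
  have h5 := Real.Gamma_pos_of_pos (s := k + γ + 1) (by linarith)
  have h6 := Real.Gamma_pos_of_pos (s := n + 2 * γ + 2) (by linarith)
  have := Real.pi_pos
  unfold sigmaSq
  positivity

lemma sigmaSq_eq_div_beta (γ : ℝ) {n k : ℕ} (hk : k ≤ n) : sigmaSq γ n k =
    2 ^ (2 * γ + 2) * π / (n + 1) * (ProbabilityTheory.beta (n - k + 1 + γ) (k + 1 + γ) /
      ProbabilityTheory.beta (n - k + 1) (k + 1)) := by
  have e1 : Real.Gamma ((n : ℝ) - k + 1) = ((n - k).factorial : ℝ) := by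
    rw [← Nat.cast_sub hk, Real.Gamma_nat_eq_factorial]
  have e2 : Real.Gamma ((k : ℝ) + 1) = (k.factorial : ℝ) := Real.Gamma_nat_eq_factorial k
  have e3 : Real.Gamma ((n : ℝ) - k + 1 + (k + 1)) = ((n + 1).factorial : ℝ) := by
    rw [← Real.Gamma_nat_eq_factorial]; congr 1; push_cast; ring
  have e4 : (n : ℝ) - k + 1 + γ + (k + 1 + γ) = n + 2 * γ + 2 := by ring
  have e5 : (n : ℝ) - k + 1 + γ = n - k + γ + 1 := by ring
  have e6 : (k : ℝ) + 1 + γ = k + γ + 1 := by ring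
  have e7 : (n.choose k : ℝ) = n.factorial / (k.factorial * (n - k).factorial) :=
    Nat.cast_choose ℝ hk
  have h1 : ((n - k).factorial : ℝ) ≠ 0 := by exact_mod_cast (n - k).factorial_ne_zero
  have h2 : (k.factorial : ℝ) ≠ 0 := by exact_mod_cast k.factorial_ne_zero
  have h3 : (n : ℝ) + 1 ≠ 0 := by positivity
  rw [ProbabilityTheory.beta, ProbabilityTheory.beta, e1, e2, e3, e4, e5, e6, sigmaSq, e7,
    Nat.factorial_succ]
  push_cast
  field_simp

/-! ### The system attached to a family of orthogonal polynomials -/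

section Family

variable [hγ : Fact (-1 < γ)] {L : ℕ → Polynomial ℝ}

/-- A real polynomial with complex coefficients. -/
abbrev complexify (Q : Polynomial ℝ) : Polynomial ℂ := Q.map Complex.ofRealHom

lemma eval_complexify (Q : Polynomial ℝ) (x : ℝ) :
    (complexify Q).eval (x : ℂ) = ((Q.eval x : ℝ) : ℂ) := by
  rw [Polynomial.eval_map, ← Complex.ofRealHom_eq_coe, Polynomial.eval₂_hom]
  rfl

/-- The function `μ^{2γ+1} e^{ip(β+α)} L_n(sin α)`. -/
abbrev famVec (γ : ℝ) [Fact (-1 < γ)] (L : ℕ → Polynomial ℝ) (p : ℤ) (n : ℕ) : L2Fan γ :=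
  lineVec γ p (complexify (L n))

omit hγ in
lemma degree_complexify (hL : IsOrthogonalFamily γ L) (n : ℕ) : (complexify (L n)).degree = n := by
  rw [complexify, Polynomial.degree_map, hL.degree_eq]

lemma inner_famVec (hL : IsOrthogonalFamily γ L) {p q : ℤ} {m n : ℕ} (h : p ≠ q ∨ m ≠ n) :
    ⟪famVec γ L p m, famVec γ L q n⟫_ℂ = 0 := by
  rw [famVec, famVec, inner_lineVec]
  by_cases hpq : p = q
  · have hmn : m ≠ n := h.resolve_left (not_not.2 hpq)
    have h1 : ∫ α, conj ((complexify (L m)).eval ((Real.sin α : ℝ) : ℂ)) *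
        (complexify (L n)).eval ((Real.sin α : ℝ) : ℂ) ∂(angleMeasure γ) =
        ((∫ α, (L m).eval (Real.sin α) * (L n).eval (Real.sin α) ∂(angleMeasure γ) : ℝ) : ℂ) := by
      refine Eq.trans ?_ integral_ofReal
      congr 1; funext α
      rw [eval_complexify, eval_complexify, Complex.conj_ofReal]; push_cast; rfl
    rw [h1, integral_angleMeasure hγ.out fun x => (L m).eval x * (L n).eval x,
      hL.orthogonal m n hmn, Complex.ofReal_zero, mul_zero]
  · rw [if_neg hpq, zero_mul]

lemma reversal_famVec (hL : IsOrthogonalFamily γ L) (p : ℤ) (n : ℕ) :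
    reversal γ (famVec γ L p n) = ((-1) ^ p * (-1) ^ n : ℂ) • famVec γ L p n :=
  reversal_lineVec (P := fun n => complexify (L n)) (degree_complexify hL)
    (fun _ _ h => inner_famVec hL (Or.inr h)) n

lemma weightedXray_adjoint_famVec (hL : IsOrthogonalFamily γ L) (p : ℤ) (n : ℕ) :
    weightedXray γ (ContinuousLinearMap.adjoint (weightedXray γ) (famVec γ L p n)) =
      (modeEigenvalue γ p n : ℂ) • famVec γ L p n :=
  weightedXray_adjoint_lineVec (P := fun n => complexify (L n)) (degree_complexify hL)
    (fun _ _ h => inner_famVec hL (Or.inr h)) n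

lemma adjoint_famVec_eq_zero (hL : IsOrthogonalFamily γ L) {p : ℤ} {n : ℕ}
    (h : ∀ k ≤ n, p ≠ (n : ℤ) - 2 * k) :
    ContinuousLinearMap.adjoint (weightedXray γ) (famVec γ L p n) = 0 := by
  rw [← inner_self_eq_zero (𝕜 := ℂ), ContinuousLinearMap.adjoint_inner_left,
    weightedXray_adjoint_famVec hL, modeEigenvalue_eq_zero h]
  simp

lemma lineVec_mem_span (hL : IsOrthogonalFamily γ L) (p : ℤ) (Q : Polynomial ℂ) :
    lineVec γ p Q ∈ Submodule.span ℂ (range fun n => famVec γ L p n) := by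
  have h := mem_span_of_degree_lt (degree_complexify hL) (Q.natDegree + 1) (Q := Q)
    (Polynomial.degree_le_natDegree.trans_lt (by exact_mod_cast Nat.lt_succ_self _))
  have h2 := Submodule.apply_mem_span_image_of_mem_span (lineVec γ p) h
  refine Submodule.span_mono ?_ h2
  rintro _ ⟨_, ⟨n, -, rfl⟩, rfl⟩
  exact ⟨n, rfl⟩

lemma eq_zero_of_forall_inner_famVec (hL : IsOrthogonalFamily γ L) (h : L2Fan γ)
    (h0 : ∀ (p : ℤ) (n : ℕ), ⟪famVec γ L p n, h⟫_ℂ = 0) : h = 0 := by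
  refine eq_zero_of_forall_inner_lineVec h fun p j => ?_
  have h1 := lineVec_mem_span hL p (X ^ j)
  have h2 : Submodule.span ℂ (range fun n => famVec γ L p n) ≤ (Submodule.span ℂ {h})ᗮ := by
    rw [Submodule.span_le]
    rintro _ ⟨n, rfl⟩
    rw [SetLike.mem_coe, Submodule.mem_orthogonal_singleton_iff_inner_left]
    exact h0 p n
  exact Submodule.mem_orthogonal_singleton_iff_inner_left.1 (h2 h1)

lemma eq_zero_of_forall_inner_adjoint_famVec (hL : IsOrthogonalFamily γ L) (f : L2Disk γ)
    (h0 : ∀ (p : ℤ) (n : ℕ),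
      ⟪ContinuousLinearMap.adjoint (weightedXray γ) (famVec γ L p n), f⟫_ℂ = 0) : f = 0 := by
  have hA : weightedXray γ f = 0 := eq_zero_of_forall_inner_famVec hL _ fun p n => by
    rw [← ContinuousLinearMap.adjoint_inner_left, h0]
  refine eq_zero_of_forall_inner_diskVec f fun a b => ?_
  have h1 := adjoint_lineVec_X_pow (γ := γ) (j := a + b) (k := b) (Nat.le_add_left b a)
  have h2 := ContinuousLinearMap.adjoint_inner_left (weightedXray γ) f
    (lineVec γ (((a + b : ℕ) : ℤ) - 2 * b) (X ^ (a + b)))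
  rw [h1, hA, inner_zero_right, inner_smul_left, Nat.add_sub_cancel] at h2
  refine (mul_eq_zero.1 h2).resolve_left ?_
  have h3 : ((a + b).choose b : ℂ) ≠ 0 := by
    exact_mod_cast (Nat.choose_pos (Nat.le_add_left b a)).ne'
  have h4 : (2 * Complex.I)⁻¹ ≠ 0 := by simp
  refine (map_ne_zero _).2 ?_
  exact mul_ne_zero (mul_ne_zero (mul_ne_zero (mul_ne_zero (by simp [Real.pi_ne_zero])
    (by simp)) (by simp)) (pow_ne_zero _ h4)) h3

lemma famVec_ne_zero (hL : IsOrthogonalFamily γ L) (p : ℤ) (n : ℕ) : famVec γ L p n ≠ 0 := by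
  refine lineVec_ne_zero fun h => ?_
  have := degree_complexify hL n
  rw [h, Polynomial.degree_zero] at this
  exact absurd this (by simp)

/-- The constant that relates `ψ_{n,k}` to `μ^{2γ+1} e^{i(n-2k)(β+α)} L_n(sin α)`. -/
def psiConst (n : ℕ) : ℂ := (-1) ^ n / (2 * (π : ℂ))

omit hγ in
lemma psiConst_ne_zero (n : ℕ) : psiConst n ≠ 0 := by
  simp [psiConst, Real.pi_ne_zero]

omit hγ in
lemma psi_eq (n : ℕ) (k : ℤ) : psi γ L n k = psiConst n • fun p =>
    ((muBdf p ^ (2 * γ + 1) : ℝ) : ℂ) * lineFun ((n : ℤ) - 2 * k) (complexify (L n)) p := by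
  funext p
  simp only [psi, psiConst, Pi.smul_apply, lineFun, smul_eq_mul, cis_zsmul, eval_complexify]
  ring

lemma memLp_psi (n : ℕ) (k : ℤ) : MemLp (psi γ L n k) 2 (fanMeasure γ) := by
  rw [psi_eq]
  exact (memLp_muBdf_mul (memLp_lineFun _ _)).const_smul _

/-- `ψ_{n,k}` as an element of `L²(∂₊S𝔻, μ^{-2γ})`. -/
abbrev psiVec (γ : ℝ) [Fact (-1 < γ)] (L : ℕ → Polynomial ℝ) (n : ℕ) (k : ℤ) : L2Fan γ :=
  (memLp_psi n k).toLp (psi γ L n k)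

lemma psiVec_eq (n : ℕ) (k : ℤ) :
    psiVec γ L n k = psiConst n • famVec γ L ((n : ℤ) - 2 * k) n := by
  rw [famVec, lineVec_apply, ← MemLp.toLp_const_smul]
  exact MemLp.toLp_congr _ _ (Filter.Eventually.of_forall fun p => by rw [psi_eq])

lemma psiVec_ne_zero (hL : IsOrthogonalFamily γ L) (n : ℕ) (k : ℤ) : psiVec γ L n k ≠ 0 := by
  rw [psiVec_eq]
  exact smul_ne_zero (psiConst_ne_zero n) (famVec_ne_zero hL _ n)

lemma inner_psiVec (hL : IsOrthogonalFamily γ L) {m n : ℕ} {l k : ℤ} (h : (m, l) ≠ (n, k)) :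
    ⟪psiVec γ L m l, psiVec γ L n k⟫_ℂ = 0 := by
  rw [psiVec_eq, psiVec_eq, inner_smul_left, inner_smul_right, inner_famVec hL, mul_zero, mul_zero]
  by_contra! hcon
  obtain ⟨h1, rfl⟩ := hcon
  exact h (by rw [show l = k by omega])

lemma weightedXray_adjoint_psiVec (hL : IsOrthogonalFamily γ L) {n k : ℕ} (hk : k ≤ n) :
    weightedXray γ (ContinuousLinearMap.adjoint (weightedXray γ) (psiVec γ L n k)) =
      (sigmaSq γ n k : ℂ) • psiVec γ L n k := by
  rw [psiVec_eq, map_smul, map_smul, weightedXray_adjoint_famVec hL, modeEigenvalue_sub n hk,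
    smul_comm]

lemma adjoint_psiVec_eq_zero (hL : IsOrthogonalFamily γ L) {n : ℕ} {k : ℤ}
    (h : k < 0 ∨ (n : ℤ) < k) :
    ContinuousLinearMap.adjoint (weightedXray γ) (psiVec γ L n k) = 0 := by
  rw [psiVec_eq, map_smul, adjoint_famVec_eq_zero hL (fun l hl => by omega), smul_zero]

lemma reversal_psiVec (hL : IsOrthogonalFamily γ L) (n : ℕ) (k : ℤ) :
    reversal γ (psiVec γ L n k) = psiVec γ L n k := by
  rw [psiVec_eq, map_smul, reversal_famVec hL]
  have : ((-1) ^ ((n : ℤ) - 2 * k) * (-1) ^ n : ℂ) = 1 := by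
    rw [zpow_sub₀ (by norm_num), zpow_mul, zpow_natCast]
    norm_num [← mul_pow]
  rw [this, one_smul]

/-- The `ψ_{n,k}` are total among the even functions: the remaining modes `e^{ip(β+α)}` times
`μ^{2γ+1} L_n(sin α)`, with `n - p` odd, are odd. -/
lemma eq_zero_of_forall_inner_psiVec (hL : IsOrthogonalFamily γ L) {g : L2Fan γ}
    (hg : reversal γ g = g) (h0 : ∀ (n : ℕ) (k : ℤ), ⟪psiVec γ L n k, g⟫_ℂ = 0) : g = 0 := by
  refine eq_zero_of_forall_inner_famVec hL g fun p n => ?_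
  rcases Int.even_or_odd ((n : ℤ) - p) with ⟨k, hk⟩ | ⟨k, hk⟩
  · have h1 := h0 n k
    rw [psiVec_eq, inner_smul_left, show (n : ℤ) - 2 * k = p by omega] at h1
    exact (mul_eq_zero.1 h1).resolve_left ((map_ne_zero _).2 (psiConst_ne_zero n))
  · have h1 := inner_reversal_left (famVec γ L p n) g
    have h2 : ((-1) ^ p * (-1) ^ n : ℂ) = -1 := by
      have : p = n + (-2) * k + (-1) := by omega
      rw [this, zpow_add₀ (by norm_num), zpow_add₀ (by norm_num), zpow_mul, zpow_natCast]
      have h3 : ((-1 : ℂ) ^ n) * (-1) ^ n = 1 := by rw [← mul_pow]; norm_num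
      norm_num [h3]
    rw [hg, reversal_famVec hL, h2, inner_smul_left] at h1
    simp only [map_neg, map_one, neg_mul, one_mul] at h1
    exact self_eq_neg.1 h1.symm

/-- The closed span `N` of the `ψ_{n,k}` with `k < 0` or `k > n`. -/
abbrev kernelSpace (γ : ℝ) [Fact (-1 < γ)] (L : ℕ → Polynomial ℝ) : Submodule ℂ (L2Fan γ) :=
  (Submodule.span ℂ {g | ∃ (n : ℕ) (k : ℤ), (k < 0 ∨ (n : ℤ) < k) ∧
    g = psiVec γ L n k}).topologicalClosure

lemma kernelSpace_le (hL : IsOrthogonalFamily γ L) {g : L2Fan γ} (hg : g ∈ kernelSpace γ L) :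
    ContinuousLinearMap.adjoint (weightedXray γ) g = 0 ∧ reversal γ g = g := by
  have h : kernelSpace γ L ≤
      LinearMap.ker (ContinuousLinearMap.adjoint (weightedXray γ) : L2Fan γ →ₗ[ℂ] L2Disk γ) ⊓
        LinearMap.ker (((reversal γ).toContinuousLinearMap - ContinuousLinearMap.id ℂ _ :
          L2Fan γ →L[ℂ] L2Fan γ) : L2Fan γ →ₗ[ℂ] L2Fan γ) := by
    refine Submodule.topologicalClosure_minimal _ ?_ ?_
    · rw [Submodule.span_le]
      rintro _ ⟨n, k, hk, rfl⟩
      refine ⟨adjoint_psiVec_eq_zero hL hk, ?_⟩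
      simp [reversal_psiVec hL]
    · exact (ContinuousLinearMap.isClosed_ker _).inter (ContinuousLinearMap.isClosed_ker _)
  have h1 := h hg
  refine ⟨h1.1, ?_⟩
  have h2 := h1.2
  simpa [sub_eq_zero] using h2

lemma mem_kernelSpace_iff (hL : IsOrthogonalFamily γ L) (g : L2Fan γ) :
    g ∈ kernelSpace γ L ↔
      ContinuousLinearMap.adjoint (weightedXray γ) g = 0 ∧ reversal γ g = g := by
  refine ⟨kernelSpace_le hL, fun ⟨h1, h2⟩ => ?_⟩
  set N := kernelSpace γ L with hN
  have : CompleteSpace N := (Submodule.isClosed_topologicalClosure _).completeSpace_coe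
  -- the component `r` of `g` orthogonal to `N` is orthogonal to all `ψ_{n,k}`
  set r := g - N.starProjection g with hr
  have hP := kernelSpace_le hL (N.starProjection_apply_mem g)
  have hrB : ContinuousLinearMap.adjoint (weightedXray γ) r = 0 := by
    rw [hr, map_sub, h1, hP.1, sub_zero]
  have hrU : reversal γ r = r := by rw [hr, map_sub, h2, hP.2]
  have hrN : r ∈ Nᗮ := N.sub_starProjection_mem_orthogonal g
  have h0 : r = 0 := by
    refine eq_zero_of_forall_inner_psiVec hL hrU fun n k => ?_
    by_cases hk : k < 0 ∨ (n : ℤ) < k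
    · exact (Submodule.mem_orthogonal _ _).1 hrN _
        (Submodule.le_topologicalClosure _ (Submodule.subset_span ⟨n, k, hk, rfl⟩))
    · push Not at hk
      lift k to ℕ using hk.1
      have hk' : k ≤ n := by exact_mod_cast hk.2
      have h3 := ContinuousLinearMap.adjoint_inner_right (weightedXray γ)
        (ContinuousLinearMap.adjoint (weightedXray γ) (psiVec γ L n k)) r
      rw [hrB, inner_zero_right, weightedXray_adjoint_psiVec hL hk', inner_smul_left] at h3
      refine (mul_eq_zero.1 h3.symm).resolve_left ?_
      refine (map_ne_zero _).2 ?_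
      exact_mod_cast (sigmaSq_pos hγ.out hk').ne'
  rw [hr, sub_eq_zero] at h0
  rw [h0]
  exact N.starProjection_apply_mem g

lemma adjoint_eq_zero_of_odd {g : L2Fan γ} (hg : reversal γ g = -g) :
    ContinuousLinearMap.adjoint (weightedXray γ) g = 0 := by
  rw [← inner_self_eq_zero (𝕜 := ℂ), ContinuousLinearMap.adjoint_inner_left]
  set f := ContinuousLinearMap.adjoint (weightedXray γ) g
  have h := inner_reversal_left g (weightedXray γ f)
  rw [hg, reversal_weightedXray, inner_neg_left] at h
  exact self_eq_neg.1 h.symm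

lemma adjoint_eq_zero_iff (hL : IsOrthogonalFamily γ L) (g : L2Fan γ) :
    ContinuousLinearMap.adjoint (weightedXray γ) g = 0 ↔
      ∃ g₁ ∈ kernelSpace γ L, ∃ g₂, reversal γ g₂ = -g₂ ∧ g = g₁ + g₂ := by
  constructor
  · intro hg
    have hodd : reversal γ ((2⁻¹ : ℂ) • (g - reversal γ g)) =
        -((2⁻¹ : ℂ) • (g - reversal γ g)) := by
      rw [map_smul, map_sub, reversal_reversal, ← smul_neg, neg_sub]
    have hsum : g = (2⁻¹ : ℂ) • (g + reversal γ g) + (2⁻¹ : ℂ) • (g - reversal γ g) := by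
      rw [← smul_add, add_add_sub_cancel, ← two_smul ℂ, smul_smul]; norm_num
    refine ⟨(2⁻¹ : ℂ) • (g + reversal γ g), (mem_kernelSpace_iff hL _).2 ⟨?_, ?_⟩, _, hodd, hsum⟩
    · have h1 := hg
      rwa [hsum, map_add, adjoint_eq_zero_of_odd hodd, add_zero] at h1
    · rw [map_smul, map_add, reversal_reversal, add_comm]
  · rintro ⟨g₁, h1, g₂, h2, rfl⟩
    rw [map_add, (kernelSpace_le hL h1).1, adjoint_eq_zero_of_odd h2, add_zero]

/-! ### The singular value decomposition -/

lemma isSVD_weightedXray (hL : IsOrthogonalFamily γ L) :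
    IsSVD (ι := Idx)
      ((LinearMap.ker (ContinuousLinearMap.adjoint (weightedXray γ) :
        L2Fan γ →ₗ[ℂ] L2Disk γ)).mkQL ∘L weightedXray γ)
      (fun i => NormedSpace.normalize
        (ContinuousLinearMap.adjoint (weightedXray γ) (psiVec γ L i.1.1 i.1.2)))
      (fun i => Submodule.Quotient.mk (NormedSpace.normalize (psiVec γ L i.1.1 i.1.2)))
      (fun i => √(sigmaSq γ i.1.1 i.1.2)) := by
  refine isSVD_of_eigenvectors (weightedXray γ) (v := fun i : Idx => psiVec γ L i.1.1 i.1.2)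
    (s := fun i : Idx => sigmaSq γ i.1.1 i.1.2) (fun i => sigmaSq_pos hγ.out i.2)
    (fun i => psiVec_ne_zero hL _ _) ?_ (fun i => weightedXray_adjoint_psiVec hL i.2) ?_
  · rintro ⟨⟨n, k⟩, hi⟩ ⟨⟨m, l⟩, hj⟩ hij
    refine inner_psiVec hL fun h => hij ?_
    simp only [Prod.mk.injEq, Nat.cast_inj] at h
    simp [h.1, h.2]
  · intro f hf
    refine eq_zero_of_forall_inner_adjoint_famVec hL f fun p n => ?_
    by_cases h : ∃ k ≤ n, p = (n : ℤ) - 2 * k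
    · obtain ⟨k, hk, rfl⟩ := h
      have h2 := hf ⟨(n, k), hk⟩
      rw [psiVec_eq, map_smul, inner_smul_left] at h2
      exact (mul_eq_zero.1 h2).resolve_left ((map_ne_zero _).2 (psiConst_ne_zero n))
    · push Not at h
      rw [adjoint_famVec_eq_zero hL h, inner_zero_left]

end Family

end XRaySVD

end

theorem theorem2p1 (γ : ℝ) (hγ : -1 < γ) :
    ∃ (A : XRaySVD.L2Disk γ →L[ℂ] XRaySVD.L2Fan γ) (B : XRaySVD.L2Fan γ →L[ℂ] XRaySVD.L2Disk γ),
      XRaySVD.IsWeightedXray γ A ∧ XRaySVD.IsWeightedBackproj γ B ∧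
      B = ContinuousLinearMap.adjoint A ∧ (∀ f, XRaySVD.IsEven γ (A f)) ∧
      ∀ L : ℕ → Polynomial ℝ, XRaySVD.IsOrthogonalFamily γ L →
        ∃ hψ : ∀ (n : ℕ) (k : ℤ), MemLp (XRaySVD.psi γ L n k) 2 (XRaySVD.fanMeasure γ),
          let ψ : ℕ → ℤ → XRaySVD.L2Fan γ := fun n k => (hψ n k).toLp (XRaySVD.psi γ L n k)
          let G : ℕ → ℤ → XRaySVD.L2Disk γ := fun n k => B (ψ n k)
          let N : Submodule ℂ (XRaySVD.L2Fan γ) := (Submodule.span ℂ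
            {g | ∃ (n : ℕ) (k : ℤ), (k < 0 ∨ (n : ℤ) < k) ∧ g = ψ n k}).topologicalClosure
          -- (1) the kernel, within the even functions and in the whole space
          (∀ g, g ∈ N ↔ B g = 0 ∧ XRaySVD.IsEven γ g) ∧
          (∀ g, B g = 0 ↔ ∃ g₁ ∈ N, ∃ g₂, XRaySVD.IsOdd γ g₂ ∧ g = g₁ + g₂) ∧
          -- (2) the singular value decomposition, modulo the kernel
          XRaySVD.IsSVD (ι := XRaySVD.Idx)
            ((LinearMap.ker (B : XRaySVD.L2Fan γ →ₗ[ℂ] XRaySVD.L2Disk γ)).mkQL ∘L A)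
            (fun i => NormedSpace.normalize (G i.1.1 i.1.2))
            (fun i => Submodule.Quotient.mk (NormedSpace.normalize (ψ i.1.1 i.1.2)))
            (fun i => √(XRaySVD.sigmaSq γ i.1.1 i.1.2)) ∧
          (∀ i : XRaySVD.Idx,
            A (NormedSpace.normalize (G i.1.1 i.1.2)) =
                (√(XRaySVD.sigmaSq γ i.1.1 i.1.2) : ℂ) • NormedSpace.normalize (ψ i.1.1 i.1.2) ∧
            B (NormedSpace.normalize (ψ i.1.1 i.1.2)) =
                (√(XRaySVD.sigmaSq γ i.1.1 i.1.2) : ℂ) • NormedSpace.normalize (G i.1.1 i.1.2)) ∧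
          (∀ n k : ℕ, k ≤ n → XRaySVD.sigmaSq γ n k =
            2 ^ (2 * γ + 2) * π / (n + 1) *
              (ProbabilityTheory.beta (n - k + 1 + γ) (k + 1 + γ) /
                ProbabilityTheory.beta (n - k + 1) (k + 1))) := by
  have hF : Fact (-1 < γ) := ⟨hγ⟩
  refine ⟨XRaySVD.weightedXray γ, ContinuousLinearMap.adjoint (XRaySVD.weightedXray γ),
    XRaySVD.isWeightedXray_weightedXray, XRaySVD.isWeightedBackproj_adjoint, rfl,
    fun f => (XRaySVD.isEven_iff _).2 (XRaySVD.reversal_weightedXray f), fun L hL => ?_⟩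
  refine ⟨XRaySVD.memLp_psi, fun g => ?_, fun g => ?_, XRaySVD.isSVD_weightedXray hL, fun i => ?_,
    fun n k hk => XRaySVD.sigmaSq_eq_div_beta γ hk⟩
  · rw [XRaySVD.isEven_iff]
    exact XRaySVD.mem_kernelSpace_iff hL g
  · simp only [XRaySVD.isOdd_iff]
    exact XRaySVD.adjoint_eq_zero_iff hL g
  · have hs := XRaySVD.sigmaSq_pos hγ i.2
    have he := XRaySVD.weightedXray_adjoint_psiVec hL i.2
    exact ⟨XRaySVD.apply_normalize_of_eigenvector _ hs he,
      XRaySVD.adjoint_normalize_of_eigenvector _ hs he⟩
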